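/- For an integer $n\ge 0$ and real $\alpha>-1$ let $$L_n^{(\alpha)}(s)=\sum_{j=0}^{n}\frac{\Gamma(n+\alpha+1)}{\Gamma(j+\alpha+1)\,(n-j)!}\,\frac{(-s)^j}{j!}$$ be the generalised Laguerre polynomial. Let $N,k$ be integers with $k\ge 1$ and $N>k-1$, and let $C$ be a positively oriented circle around $0$ of radius less than $1$. For $x\in\mathbb C$ put $$w_0(s)=w_0(s;x)=\frac{e^{x/(1-s)}}{(1-s)^{2k}s^{N+k}},\qquad H_k(x)=H_k[w_0]=\det\left[\int_C w_0(s)\,s^{i+j}\,ds\right]_{i,j=0,\dots,k-1}.$$ Then for every real $y$, with $x=2|y|$, $$\det\left[L^{(2k-1)}_{N+k-1-(i+j)}(-2|y|)\right]_{i,j=0,\dots,k-1}=\frac{e^{-2k|y|}}{(2\pi i)^k}\,H_k[w_0].$$ Furthermore, $H_k$ is an entire function of $x$ with $H_k(0)\neq 0$, and there is a function $\sigma$, analytic on $\{x\in\mathbb C: H_k(x)\ne 0\}$, such that $$\frac{d}{dx}\log H_k(x)=\frac{H_k'(x)}{H_k(x)}=\frac{\sigma(x)+kx+Nk}{x}\qquad\text{whenever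 } H_k(x)\neq 0,\ x\ne 0,$$ such that $\sigma$ satisfies the $\sigma$-Painlevé V equation $$\left(x\sigma''\right)^2=\left(\sigma-x\sigma'+2(\sigma')^2-2N\sigma'\right)^2-4\sigma'\left(-N+\sigma'\right)\left(-k-N+\sigma'\right)\left(k+\sigma'\right)$$ at every $x$ with $H_k(x)\neq 0$, and such that $$\sigma(x)=-Nk+\frac N2x+\mathcal O(x^2),\qquad x\to 0 .$$ -/

import Mathlib

/-- The generalised Laguerre polynomial `L_n^{(α)}(s)`. -/
noncomputable def laguerreL (α : ℝ) (n : ℕ) (s : ℝ) : ℝ :=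
  ∑ j ∈ Finset.range (n + 1),
    Real.Gamma (n + α + 1) / (Real.Gamma (j + α + 1) * (Nat.factorial (n - j) : ℝ)) *
      ((-s) ^ j / (Nat.factorial j : ℝ))

/-- The weight `w₀(s) = e^{x/(1-s)} / ((1-s)^{2k} s^{N+k})`. -/
noncomputable def weightW (N k : ℕ) (x s : ℂ) : ℂ :=
  Complex.exp (x / (1 - s)) / ((1 - s) ^ (2 * k) * s ^ (N + k))

/-- The Hankel determinant `H_n[w]` of the moments of `w` over the positively oriented circle
of radius `r` around `0`. -/
noncomputable def hankelDet (r : ℝ) (n : ℕ) (w : ℂ → ℂ) : ℂ :=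
  Matrix.det (Matrix.of fun i j : Fin n =>
    circleIntegral (fun s => w s * s ^ ((i : ℕ) + (j : ℕ))) 0 r)

/-- The `σ`-Painlevé V equation with parameters `N`, `k`, for the function `σ` at the point `x`. -/
def SigmaPainleveV (N k : ℕ) (σ : ℂ → ℂ) (x : ℂ) : Prop :=
  (x * deriv (deriv σ) x) ^ 2 =
    (σ x - x * deriv σ x + 2 * (deriv σ x) ^ 2 - 2 * N * deriv σ x) ^ 2
      - 4 * deriv σ x * (-N + deriv σ x) * (-k - N + deriv σ x) * (k + deriv σ x)

section expMoment

open Complex Metric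

/-- The moment `∮ e^{x/(1-s)} (1-s)^{-α} s^{-n} ds` over the circle of radius `r` around `0`. -/
noncomputable def expMoment (r : ℝ) (α n : ℕ) (x : ℂ) : ℂ :=
  ∮ s in C(0, r), exp (x / (1 - s)) / ((1 - s) ^ α * s ^ n)

variable {r : ℝ}

theorem one_sub_ne_zero_of_norm_lt_one {s : ℂ} (hs : ‖s‖ < 1) : 1 - s ≠ 0 := by
  intro h
  rw [← sub_eq_zero.1 h] at hs
  simp at hs

theorem one_sub_ne_zero_of_mem_sphere (hr1 : r < 1) {s : ℂ} (hs : s ∈ sphere (0 : ℂ) r) :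
    1 - s ≠ 0 :=
  one_sub_ne_zero_of_norm_lt_one (by rw [mem_sphere_zero_iff_norm.1 hs]; exact hr1)

theorem ne_zero_of_mem_sphere_zero (hr0 : 0 < r) {s : ℂ} (hs : s ∈ sphere (0 : ℂ) r) :
    s ≠ 0 := by
  rintro rfl
  have := mem_sphere_zero_iff_norm.1 hs
  simp at this
  exact hr0.ne this

theorem continuousOn_expMoment_integrand (hr0 : 0 < r) (hr1 : r < 1) (α n : ℕ) (x : ℂ) :
    ContinuousOn (fun s => exp (x / (1 - s)) / ((1 - s) ^ α * s ^ n)) (sphere (0 : ℂ) r) := by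
  have h1 : ∀ s ∈ sphere (0 : ℂ) r, 1 - s ≠ 0 := fun s hs => one_sub_ne_zero_of_mem_sphere hr1 hs
  have h0 : ∀ s ∈ sphere (0 : ℂ) r, s ≠ 0 := fun s hs => ne_zero_of_mem_sphere_zero hr0 hs
  refine ContinuousOn.div ?_ (by fun_prop)
    fun s hs => mul_ne_zero (pow_ne_zero _ (h1 s hs)) (pow_ne_zero _ (h0 s hs))
  exact (continuousOn_const.div (by fun_prop) h1).cexp

theorem circleIntegrable_expMoment (hr0 : 0 < r) (hr1 : r < 1) (α n : ℕ) (x : ℂ) :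
    CircleIntegrable (fun s => exp (x / (1 - s)) / ((1 - s) ^ α * s ^ n)) 0 r :=
  (continuousOn_expMoment_integrand hr0 hr1 α n x).circleIntegrable hr0.le

theorem hasDerivAt_expMoment (hr0 : 0 < r) (hr1 : r < 1) (α n : ℕ) (x : ℂ) :
    HasDerivAt (expMoment r α n) (expMoment r (α + 1) n x) x := by
  have hc (α : ℕ) (x : ℂ) : Continuous fun θ : ℝ => deriv (circleMap 0 r) θ •
      (exp (x / (1 - circleMap 0 r θ)) / ((1 - circleMap 0 r θ) ^ α * circleMap 0 r θ ^ n)) := by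
    have h := (continuousOn_expMoment_integrand hr0 hr1 α n x).comp_continuous
      (continuous_circleMap 0 r) (circleMap_mem_sphere 0 hr0.le)
    simp only [deriv_circleMap]
    exact ((continuous_circleMap 0 r).mul continuous_const).smul h
  have hB : ∀ θ : ℝ, ∀ y ∈ ball x 1,
      ‖deriv (circleMap 0 r) θ • (exp (y / (1 - circleMap 0 r θ)) /
        ((1 - circleMap 0 r θ) ^ (α + 1) * circleMap 0 r θ ^ n))‖ ≤
      r * (Real.exp ((‖x‖ + 1) / (1 - r)) / ((1 - r) ^ (α + 1) * r ^ n)) := by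
    intro θ y hy
    have hn : ‖circleMap 0 r θ‖ = r := by simp [abs_of_pos hr0]
    have hlow : 1 - r ≤ ‖1 - circleMap 0 r θ‖ := by
      have := norm_sub_norm_le (1 : ℂ) (circleMap 0 r θ)
      rwa [hn, norm_one] at this
    have hy' : ‖y‖ ≤ ‖x‖ + 1 := by
      have h1 : ‖y - x‖ < 1 := by simpa [dist_eq_norm] using hy
      have h2 := norm_sub_norm_le y x
      linarith
    have hr : 0 < 1 - r := by linarith
    rw [norm_smul, norm_div, norm_mul, norm_pow, norm_pow, hn, deriv_circleMap, norm_mul, hn,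
      norm_I, mul_one]
    gcongr
    rw [norm_exp]
    gcongr
    refine (re_le_norm _).trans ?_
    rw [norm_div]
    gcongr
  have := (intervalIntegral.hasDerivAt_integral_of_dominated_loc_of_deriv_le
    (μ := MeasureTheory.volume) (a := 0) (b := 2 * Real.pi)
    (F := fun y θ => deriv (circleMap 0 r) θ •
      (exp (y / (1 - circleMap 0 r θ)) / ((1 - circleMap 0 r θ) ^ α * circleMap 0 r θ ^ n)))
    (F' := fun y θ => deriv (circleMap 0 r) θ •
      (exp (y / (1 - circleMap 0 r θ)) / ((1 - circleMap 0 r θ) ^ (α + 1) * circleMap 0 r θ ^ n)))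
    (x₀ := x) (ball_mem_nhds x one_pos)
    (Filter.Eventually.of_forall fun y => (hc α y).aestronglyMeasurable)
    ((hc α x).intervalIntegrable _ _) (hc (α + 1) x).aestronglyMeasurable
    (Filter.Eventually.of_forall fun θ _ => hB θ) (intervalIntegrable_const)
    (Filter.Eventually.of_forall fun θ _ y _ => ?_)).2
  · exact this
  · have h1 : 1 - circleMap 0 r θ ≠ 0 :=
      one_sub_ne_zero_of_mem_sphere hr1 (circleMap_mem_sphere 0 hr0.le θ)
    have h := ((((hasDerivAt_id y).div_const (1 - circleMap 0 r θ)).cexp).div_const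
      ((1 - circleMap 0 r θ) ^ α * circleMap 0 r θ ^ n)).const_smul (deriv (circleMap 0 r) θ)
    convert h using 1
    congr 1
    simp only [id]
    rw [pow_succ]
    field_simp

theorem expMoment_succ_sub (hr0 : 0 < r) (hr1 : r < 1) (α n : ℕ) (x : ℂ) :
    expMoment r (α + 1) (n + 1) x - expMoment r α (n + 1) x = expMoment r (α + 1) n x := by
  rw [expMoment, expMoment, ← circleIntegral.integral_sub
    (circleIntegrable_expMoment hr0 hr1 _ _ x) (circleIntegrable_expMoment hr0 hr1 _ _ x)]
  refine circleIntegral.integral_congr hr0.le fun s hs => ?_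
  have h1 := one_sub_ne_zero_of_mem_sphere hr1 hs
  have h0 := ne_zero_of_mem_sphere_zero hr0 hs
  simp only [pow_succ]
  field_simp
  ring

theorem expMoment_integration_by_parts (hr0 : 0 < r) (hr1 : r < 1) (α n : ℕ) (x : ℂ) :
    x * expMoment r (α + 2) n x + α * expMoment r (α + 1) n x -
      n * expMoment r α (n + 1) x = 0 := by
  simp only [expMoment]
  rw [← circleIntegral.integral_const_mul, ← circleIntegral.integral_const_mul,
    ← circleIntegral.integral_const_mul]
  have hi (c : ℂ) (α n : ℕ) :
      CircleIntegrable (fun s => c * (exp (x / (1 - s)) / ((1 - s) ^ α * s ^ n))) 0 r :=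
    (continuousOn_const.mul (continuousOn_expMoment_integrand hr0 hr1 α n x)).circleIntegrable
      hr0.le
  have hadd : CircleIntegrable (fun s => x * (exp (x / (1 - s)) / ((1 - s) ^ (α + 2) * s ^ n)) +
      α * (exp (x / (1 - s)) / ((1 - s) ^ (α + 1) * s ^ n))) 0 r := (hi _ _ _).add (hi _ _ _)
  rw [← circleIntegral.integral_add (hi _ _ _) (hi _ _ _),
    ← circleIntegral.integral_sub hadd (hi _ _ _)]
  refine circleIntegral.integral_eq_zero_of_hasDerivWithinAt hr0.le
    (f := fun s => exp (x / (1 - s)) * ((1 - s) ^ α)⁻¹ * (s ^ n)⁻¹) fun s hs => ?_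
  have h1 := one_sub_ne_zero_of_mem_sphere hr1 hs
  have h0 := ne_zero_of_mem_sphere_zero hr0 hs
  have hd : HasDerivAt (fun s : ℂ => 1 - s) (-1) s := by
    simpa using (hasDerivAt_id s).const_sub 1
  have hexp := ((hasDerivAt_const s x).div hd h1).cexp
  have hpow (m : ℕ) {g : ℂ → ℂ} {g' : ℂ} (hg : HasDerivAt g g' s) (hgs : g s ≠ 0) :
      HasDerivAt (fun s => (g s ^ m)⁻¹) (-m * g' / g s ^ (m + 1)) s := by
    have := (hasDerivAt_zpow (-m : ℤ) (g s) (Or.inl hgs)).comp s hg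
    rw [show (fun s => (g s ^ m)⁻¹) = (fun x => x ^ (-m : ℤ)) ∘ g by funext y; simp]
    refine this.congr_deriv ?_
    rw [zpow_sub₀ hgs, zpow_neg, zpow_natCast, zpow_one, pow_succ]
    push_cast
    field_simp
  have := ((hexp.mul (hpow α hd h1)).mul (hpow n (hasDerivAt_id s) h0))
  refine (this.hasDerivWithinAt).congr_deriv ?_
  simp only [Pi.div_apply, Pi.mul_apply, id, pow_succ]
  field_simp
  ring

theorem expMoment_zero_right (hr0 : 0 < r) (hr1 : r < 1) (α : ℕ) (x : ℂ) :
    expMoment r α 0 x = 0 := by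
  have h1 : ∀ s ∈ closedBall (0 : ℂ) r, 1 - s ≠ 0 := fun s hs =>
    one_sub_ne_zero_of_norm_lt_one ((mem_closedBall_zero_iff.1 hs).trans_lt hr1)
  refine circleIntegral_eq_zero_of_differentiable_on_off_countable hr0.le Set.countable_empty
    ?_ fun s hs => ?_
  · refine ContinuousOn.div ?_ (by fun_prop)
      fun s hs => by simpa using pow_ne_zero α (h1 s hs)
    exact (continuousOn_const.div (by fun_prop) h1).cexp
  · have hs1 := h1 s (ball_subset_closedBall hs.1)
    refine DifferentiableAt.div ?_ (by fun_prop) (by simpa using pow_ne_zero α hs1)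
    exact ((differentiableAt_const x).div (by fun_prop) hs1).cexp

theorem expMoment_zero_left_zero (hr0 : 0 < r) (n : ℕ) :
    expMoment r 0 (n + 1) 0 = if n = 0 then 2 * Real.pi * I else 0 := by
  have : expMoment r 0 (n + 1) 0 = ∮ s in C(0, r), (s - 0) ^ (-(n + 1 : ℕ) : ℤ) := by
    refine circleIntegral.integral_congr hr0.le fun s _ => ?_
    simp only [zpow_neg, zpow_natCast]
    simp
  rw [this]
  split_ifs with h
  · subst h
    simpa using circleIntegral.integral_sub_center_inv (0 : ℂ) hr0.ne'
  · exact circleIntegral.integral_sub_zpow_of_ne (by omega) _ _ _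

theorem expMoment_apply_zero (hr0 : 0 < r) (hr1 : r < 1) (β n : ℕ) :
    expMoment r (β + 1) (n + 1) 0 = 2 * Real.pi * I * (n + β).choose n := by
  induction β generalizing n with
  | zero =>
    induction n with
    | zero =>
      have h := expMoment_succ_sub hr0 hr1 0 0 0
      rw [expMoment_zero_right hr0 hr1, expMoment_zero_left_zero hr0, if_pos rfl] at h
      simpa using sub_eq_zero.1 h
    | succ n ih =>
      have h := expMoment_succ_sub hr0 hr1 0 (n + 1) 0
      rw [ih, expMoment_zero_left_zero hr0, if_neg n.succ_ne_zero, sub_zero] at h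
      simpa using h
  | succ β ihβ =>
    induction n with
    | zero =>
      have h := expMoment_succ_sub hr0 hr1 (β + 1) 0 0
      rw [expMoment_zero_right hr0 hr1, ihβ] at h
      simpa using sub_eq_zero.1 h
    | succ n ih =>
      have h := expMoment_succ_sub hr0 hr1 (β + 1) (n + 1) 0
      rw [ih, ihβ] at h
      rw [sub_eq_iff_eq_add.1 h, show n + 1 + (β + 1) = (n + (β + 1)) + 1 by ring,
        Nat.choose_succ_succ, show n + 1 + β = n + (β + 1) by ring]
      push_cast
      ring

theorem expMoment_eq_sum (hr0 : 0 < r) (hr1 : r < 1) (β n : ℕ) (x : ℂ) :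
    expMoment r (β + 1) (n + 1) x = 2 * Real.pi * I * exp x *
      ∑ l ∈ Finset.range (n + 1), ((n + β).choose (n - l) : ℂ) * (x ^ l / l.factorial) := by
  suffices h : ∀ β x, exp (-x) * expMoment r (β + 1) (n + 1) x = 2 * Real.pi * I *
      ∑ l ∈ Finset.range (n + 1), ((n + β).choose (n - l) : ℂ) * (x ^ l / l.factorial) by
    rw [mul_right_comm, ← h β x, mul_right_comm, ← exp_add, neg_add_cancel, exp_zero, one_mul]
  clear β x
  have hder (β n : ℕ) (x : ℂ) : HasDerivAt (fun x => exp (-x) * expMoment r (β + 1) (n + 1) x)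
      (exp (-x) * expMoment r (β + 2) n x) x := by
    refine ((hasDerivAt_neg x).cexp.mul (hasDerivAt_expMoment hr0 hr1 _ _ x)).congr_deriv ?_
    rw [← expMoment_succ_sub hr0 hr1 (β + 1) n x]
    ring
  induction n with
  | zero =>
    intro β x
    have h0 := is_const_of_deriv_eq_zero (𝕜 := ℂ)
      (f := fun x => exp (-x) * expMoment r (β + 1) (0 + 1) x)
      (fun y => (hder β 0 y).differentiableAt) (fun y => by
        rw [(hder β 0 y).deriv, expMoment_zero_right hr0 hr1, mul_zero]) x 0
    rw [h0, expMoment_apply_zero hr0 hr1]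
    simp
  | succ n ih =>
    intro β x
    set S : ℂ → ℂ := fun x => ∑ l ∈ Finset.range (n + 1 + 1),
      ((n + 1 + β).choose (n + 1 - l) : ℂ) * (x ^ l / l.factorial) with hS
    have hSd (x : ℂ) : HasDerivAt S (∑ l ∈ Finset.range (n + 1),
        ((n + (β + 1)).choose (n - l) : ℂ) * (x ^ l / l.factorial)) x := by
      rw [hS]
      simp_rw [Finset.sum_range_succ' _ (n + 1), pow_zero]
      refine HasDerivAt.congr_deriv (((HasDerivAt.fun_sum fun l _ =>
        ((hasDerivAt_pow (l + 1) x).div_const ((l + 1).factorial : ℂ)).const_mul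
          ((n + 1 + β).choose (n + 1 - (l + 1)) : ℂ))).add_const _) ?_
      refine Finset.sum_congr rfl fun l _ => ?_
      rw [show n + 1 + β = n + (β + 1) by ring, Nat.add_sub_add_right, Nat.factorial_succ,
        Nat.add_sub_cancel]
      have : ((l : ℂ) + 1) ≠ 0 := by exact_mod_cast l.succ_ne_zero
      have : (l.factorial : ℂ) ≠ 0 := by exact_mod_cast l.factorial_ne_zero
      push_cast
      field_simp
    have hg (y : ℂ) : HasDerivAt (fun x => exp (-x) * expMoment r (β + 1) (n + 1 + 1) x -
        2 * Real.pi * I * S x) 0 y := by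
      refine ((hder β (n + 1) y).sub ((hSd y).const_mul (2 * Real.pi * I))).congr_deriv ?_
      rw [ih (β + 1) y, sub_self]
    have h0 := is_const_of_deriv_eq_zero (𝕜 := ℂ)
      (fun y => (hg y).differentiableAt) (fun y => (hg y).deriv) x 0
    have hS0 : S 0 = (n + 1 + β).choose (n + 1) := by
      simp [hS, Finset.sum_range_succ']
    rw [expMoment_apply_zero hr0 hr1, hS0] at h0
    simp only [neg_zero, exp_zero, one_mul, sub_self] at h0
    exact sub_eq_zero.1 h0

theorem laguerreL_two_mul_sub_one (k n : ℕ) (hk : 1 ≤ k) (s : ℝ) :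
    laguerreL (2 * (k : ℝ) - 1) n (-s) = ∑ l ∈ Finset.range (n + 1),
      ((n + (2 * k - 1)).choose (n - l) : ℝ) * (s ^ l / l.factorial) := by
  rw [laguerreL]
  refine Finset.sum_congr rfl fun l hl => ?_
  have hl' : l ≤ n := Nat.lt_succ_iff.1 (Finset.mem_range.1 hl)
  obtain ⟨m, rfl⟩ : ∃ m, k = m + 1 := ⟨k - 1, by omega⟩
  have hG (i : ℕ) : Real.Gamma (i + (2 * ((m + 1 : ℕ) : ℝ) - 1) + 1) =
      ((i + (2 * (m + 1) - 1)).factorial : ℝ) := by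
    rw [← Real.Gamma_nat_eq_factorial, show 2 * (m + 1) - 1 = 2 * m + 1 by omega]
    push_cast
    ring_nf
  rw [hG, hG, neg_neg, Nat.cast_choose ℝ (show n - l ≤ n + (2 * (m + 1) - 1) by omega),
    show n + (2 * (m + 1) - 1) - (n - l) = l + (2 * (m + 1) - 1) by omega,
    mul_comm ((n - l).factorial : ℝ)]

end expMoment

section Hankel

open Matrix

variable (m : ℕ → ℂ → ℂ) (d : ℕ)

/-- The shifted Hankel matrix `[m_{i+j+p}(x)]`. -/
def hankelShift (p : ℕ) (x : ℂ) : Matrix (Fin (d + 1)) (Fin (d + 1)) ℂ :=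
  Matrix.of fun i j => m (i + j + p) x

/-- The projection to the last basis vector. -/
def lastProj : Matrix (Fin (d + 1)) (Fin (d + 1)) ℂ :=
  Matrix.single (Fin.last d) (Fin.last d) 1

/-- The nilpotent matrix sending each basis vector to the next one. -/
def nextShift : Matrix (Fin (d + 1)) (Fin (d + 1)) ℂ :=
  Matrix.of fun i j => if (i : ℕ) = j + 1 then 1 else 0

/-- The diagonal matrix with entries `0, …, d`. -/
def indexDiag : Matrix (Fin (d + 1)) (Fin (d + 1)) ℂ :=
  Matrix.diagonal fun i => (i : ℂ)

/-- The inverse of the Hankel matrix. -/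
noncomputable def hankelInv (x : ℂ) : Matrix (Fin (d + 1)) (Fin (d + 1)) ℂ :=
  (hankelShift m d 0 x)⁻¹

/-- The companion matrix of the orthogonal polynomial of degree `d + 1`. -/
noncomputable def companionQ (x : ℂ) : Matrix (Fin (d + 1)) (Fin (d + 1)) ℂ :=
  hankelInv m d x * hankelShift m d 1 x

/-- The squared norm of the orthogonal polynomial of degree `d + 1`. -/
noncomputable def orthNorm (x : ℂ) : ℂ :=
  (hankelShift m d 2 x - hankelShift m d 1 x * companionQ m d x) (Fin.last d) (Fin.last d)

variable {m d}

theorem hankelShift_transpose (p : ℕ) (x : ℂ) :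
    (hankelShift m d p x)ᵀ = hankelShift m d p x := by
  ext i j
  simp [hankelShift, add_comm (i : ℕ)]

theorem hankelInv_transpose (x : ℂ) : (hankelInv m d x)ᵀ = hankelInv m d x := by
  rw [hankelInv, transpose_nonsing_inv, hankelShift_transpose]

theorem lastProj_transpose : (lastProj d)ᵀ = lastProj d := by simp [lastProj]

theorem indexDiag_transpose : (indexDiag d)ᵀ = indexDiag d := by simp [indexDiag]

theorem lastProj_mul_mul_lastProj (X : Matrix (Fin (d + 1)) (Fin (d + 1)) ℂ) :
    lastProj d * X * lastProj d = X (Fin.last d) (Fin.last d) • lastProj d := by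
  simp [lastProj]

theorem trace_mul_lastProj (X : Matrix (Fin (d + 1)) (Fin (d + 1)) ℂ) :
    trace (X * lastProj d) = X (Fin.last d) (Fin.last d) := by
  simp [lastProj, Matrix.trace_mul_single]

theorem lastProj_mul_mul_lastProj_eq_trace (X : Matrix (Fin (d + 1)) (Fin (d + 1)) ℂ) :
    lastProj d * X * lastProj d = trace (X * lastProj d) • lastProj d := by
  rw [lastProj_mul_mul_lastProj, trace_mul_lastProj]

theorem lastProj_mul_indexDiag : lastProj d * indexDiag d = (d : ℂ) • lastProj d := by
  ext i j
  simp only [lastProj, indexDiag, mul_diagonal, Matrix.smul_apply, single_apply, smul_eq_mul]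
  split_ifs with h
  · rw [← h.2, Fin.val_last, mul_comm]
  · simp

theorem indexDiag_mul_nextShift :
    indexDiag d * nextShift d = nextShift d * indexDiag d + nextShift d := by
  ext i j
  simp only [indexDiag, nextShift, diagonal_mul, mul_diagonal, Matrix.add_apply, of_apply]
  split_ifs with h
  · rw [h]; push_cast; ring
  · ring

theorem trace_nextShift : trace (nextShift d) = 0 := by
  simp [trace, nextShift]

theorem trace_indexDiag_mul_nextShift : trace (indexDiag d * nextShift d) = 0 := by
  simp [trace, nextShift, indexDiag]

theorem nextShift_mul_self_diag (i : Fin (d + 1)) : (nextShift d * nextShift d) i i = 0 := by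
  simp only [mul_apply, nextShift, of_apply]
  refine Finset.sum_eq_zero fun j _ => ?_
  by_cases h : (i : ℕ) = j + 1
  · rw [if_neg (show ¬ (j : ℕ) = i + 1 by omega), mul_zero]
  · rw [if_neg h, zero_mul]

theorem trace_nextShift_mul_self : trace (nextShift d * nextShift d) = 0 := by
  simp [trace, nextShift_mul_self_diag]

theorem trace_indexDiag_mul_nextShift_mul_self :
    trace (indexDiag d * (nextShift d * nextShift d)) = 0 := by
  simp only [trace, diag_apply, indexDiag, diagonal_mul, nextShift_mul_self_diag, mul_zero,
    Finset.sum_const_zero]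

theorem hankelShift_mul_nextShift (p : ℕ) (x : ℂ) :
    hankelShift m d p x * nextShift d = hankelShift m d (p + 1) x * (1 - lastProj d) := by
  ext i j
  rw [mul_sub, mul_one, Matrix.sub_apply, lastProj, mul_apply]
  simp only [hankelShift, nextShift, of_apply, mul_ite, mul_one, mul_zero]
  by_cases hj : j = Fin.last d
  · subst hj
    rw [mul_single_apply_same, of_apply, mul_one, sub_self]
    refine Finset.sum_eq_zero fun k _ => if_neg ?_
    rw [Fin.val_last]
    omega
  · rw [mul_single_apply_of_ne _ _ _ _ _ hj, sub_zero]
    have hjd : (j : ℕ) < d := Fin.val_lt_last hj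
    rw [Finset.sum_eq_single (⟨j + 1, by omega⟩ : Fin (d + 1))]
    · simp only [if_true]
      congr 1
      ring
    · intro k _ hk
      exact if_neg fun h => hk (Fin.ext h)
    · simp

theorem hankelInv_mul {x : ℂ} (hx : (hankelShift m d 0 x).det ≠ 0) :
    hankelInv m d x * hankelShift m d 0 x = 1 :=
  nonsing_inv_mul _ hx.isUnit

theorem companionQ_mul_one_sub_lastProj {x : ℂ} (hx : (hankelShift m d 0 x).det ≠ 0) :
    companionQ m d x * (1 - lastProj d) = nextShift d := by
  rw [companionQ, mul_assoc, ← hankelShift_mul_nextShift, ← mul_assoc, hankelInv_mul hx, one_mul]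

theorem companionQ_eq {x : ℂ} (hx : (hankelShift m d 0 x).det ≠ 0) :
    companionQ m d x = nextShift d + companionQ m d x * lastProj d := by
  rw [← companionQ_mul_one_sub_lastProj hx, mul_sub, mul_one, sub_add_cancel]

theorem hankelShift_succ_sub_mul_lastProj {x : ℂ} (hx : (hankelShift m d 0 x).det ≠ 0) (p : ℕ) :
    (hankelShift m d (p + 1) x - hankelShift m d p x * companionQ m d x) * lastProj d =
      hankelShift m d (p + 1) x - hankelShift m d p x * companionQ m d x := by
  have h : (hankelShift m d (p + 1) x - hankelShift m d p x * companionQ m d x) *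
      (1 - lastProj d) = 0 := by
    rw [sub_mul, ← hankelShift_mul_nextShift, mul_assoc, companionQ_mul_one_sub_lastProj hx,
      sub_self]
  rw [mul_sub, mul_one] at h
  exact (sub_eq_zero.1 h).symm

theorem hankelShift_two_eq {x : ℂ} (hx : (hankelShift m d 0 x).det ≠ 0) :
    hankelShift m d 2 x =
      hankelShift m d 1 x * companionQ m d x + orthNorm m d x • lastProj d := by
  set X := hankelShift m d 2 x - hankelShift m d 1 x * companionQ m d x with hX
  have h1 : X * lastProj d = X := hankelShift_succ_sub_mul_lastProj hx 1
  have h2 : Xᵀ = X := by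
    simp only [hX, companionQ, transpose_sub, transpose_mul, hankelShift_transpose,
      hankelInv_transpose, mul_assoc]
  have h3 : lastProj d * X = X := by
    rw [← transpose_inj, transpose_mul, lastProj_transpose, h2, h1]
  have h4 : X = orthNorm m d x • lastProj d := by
    rw [orthNorm, ← hX, ← lastProj_mul_mul_lastProj, h3, h1]
  rw [← h4, hX]
  abel

theorem hankelInv_mul_hankelShift_two {x : ℂ} (hx : (hankelShift m d 0 x).det ≠ 0) :
    hankelInv m d x * hankelShift m d 2 x = companionQ m d x * companionQ m d x +
      orthNorm m d x • (hankelInv m d x * lastProj d) := by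
  rw [hankelShift_two_eq hx, mul_add, ← mul_assoc, ← companionQ, Matrix.mul_smul]

theorem trace_companionQ {x : ℂ} (hx : (hankelShift m d 0 x).det ≠ 0) :
    trace (companionQ m d x) = trace (companionQ m d x * lastProj d) := by
  conv_lhs => rw [companionQ_eq hx]
  rw [trace_add, trace_nextShift, zero_add]

theorem trace_indexDiag_mul_companionQ {x : ℂ} (hx : (hankelShift m d 0 x).det ≠ 0) :
    trace (indexDiag d * companionQ m d x) = d * trace (companionQ m d x) := by
  conv_lhs => rw [companionQ_eq hx]
  rw [mul_add, trace_add, trace_indexDiag_mul_nextShift, zero_add, ← mul_assoc, trace_mul_comm,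
    ← mul_assoc, lastProj_mul_indexDiag, smul_mul_assoc, trace_smul, trace_mul_comm,
    ← trace_companionQ hx, smul_eq_mul]

theorem trace_indexDiag_mul_companionQ_sq {x : ℂ} (hx : (hankelShift m d 0 x).det ≠ 0) :
    2 * trace (indexDiag d * (companionQ m d x * companionQ m d x)) =
      (2 * d - 1) * trace (companionQ m d x * companionQ m d x) +
        trace (companionQ m d x) ^ 2 := by
  set Q := companionQ m d x with hQ
  set E := lastProj d with hE
  set S := nextShift d with hS
  set R := indexDiag d with hR
  have hQQ : Q * Q = S * S + S * Q * E + Q * E * S + Q * (E * Q * E) := by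
    have h0 : Q = S + Q * E := companionQ_eq hx
    calc Q * Q = (S + Q * E) * (S + Q * E) := by rw [← h0]
      _ = _ := by noncomm_ring
  have h1 : trace (S * Q * E) = trace (E * S * Q) := by rw [trace_mul_comm, mul_assoc]
  have h2 : trace (Q * E * S) = trace (E * S * Q) := by rw [mul_assoc, trace_mul_comm]
  have h3 : E * Q * E = trace Q • E := by
    rw [hE, lastProj_mul_mul_lastProj_eq_trace, trace_companionQ hx]
  have h4 : trace (Q * E) = trace Q := (trace_companionQ hx).symm
  have hER : E * R = (d : ℂ) • E := lastProj_mul_indexDiag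
  have hESR : E * S * R = (d - 1 : ℂ) • (E * S) := by
    have : S * R = R * S - S := by rw [hS, hR, indexDiag_mul_nextShift]; abel
    rw [mul_assoc, this, mul_sub, ← mul_assoc, hER, smul_mul_assoc, sub_smul, one_smul]
  have h5 : trace (R * (S * Q * E)) = d * trace (E * S * Q) := by
    rw [← mul_assoc, trace_mul_comm, ← mul_assoc, hER, smul_mul_assoc, trace_smul, smul_eq_mul,
      ← mul_assoc]
  have h6 : trace (R * (Q * E * S)) = (d - 1) * trace (E * S * Q) := by
    rw [mul_assoc, ← mul_assoc, trace_mul_comm, ← mul_assoc, hESR, smul_mul_assoc, trace_smul,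
      smul_eq_mul]
  have h7 : trace (R * (Q * E)) = d * trace Q := by
    rw [← mul_assoc, trace_mul_comm, ← mul_assoc, hER, smul_mul_assoc, trace_smul, smul_eq_mul,
      trace_mul_comm, h4]
  have hT : trace (Q * Q) = 2 * trace (E * S * Q) + trace Q ^ 2 := by
    rw [hQQ, h3, Matrix.mul_smul]
    simp only [trace_add, trace_smul, smul_eq_mul, h1, h2, h4]
    rw [hS, trace_nextShift_mul_self]
    ring
  have hRT : trace (R * (Q * Q)) = (2 * d - 1) * trace (E * S * Q) + d * trace Q ^ 2 := by
    rw [hQQ, h3, Matrix.mul_smul]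
    simp only [mul_add, Matrix.mul_smul, trace_add, trace_smul, smul_eq_mul, h5, h6, h7]
    rw [hS, hR, trace_indexDiag_mul_nextShift_mul_self]
    ring
  rw [hT, hRT]
  ring

theorem trace_hankelInv_mul_indexDiag_mul (p : ℕ) (x : ℂ) :
    trace (hankelInv m d x * (indexDiag d * hankelShift m d p x)) =
      trace (indexDiag d * (hankelInv m d x * hankelShift m d p x)) := by
  rw [← trace_transpose, transpose_mul, transpose_mul, hankelShift_transpose, indexDiag_transpose,
    hankelInv_transpose, mul_assoc, trace_mul_comm, mul_assoc]

theorem trace_indexDiag : 2 * trace (indexDiag d) = (d : ℂ) * (d + 1) := by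
  have h : ∑ i : Fin (d + 1), ((i : ℕ) : ℂ) = ∑ i ∈ Finset.range (d + 1), (i : ℂ) :=
    Fin.sum_univ_eq_sum_range (fun i => (i : ℂ)) (d + 1)
  rw [indexDiag, trace_diagonal, h, ← Nat.cast_sum, mul_comm 2]
  have := Finset.sum_range_id_mul_two (d + 1)
  rw [Nat.add_sub_cancel] at this
  rw [mul_comm (d : ℂ)]
  exact_mod_cast this

section Recurrence

variable {x a : ℂ}

theorem smul_hankelShift_add_two
    (hrec : ∀ j : ℕ, x * m (j + 2) x = (x - j - 2) * m (j + 1) x + (j + 1 + a) * m j x) (p : ℕ) :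
    x • hankelShift m d (p + 2) x = (x - (p + 2)) • hankelShift m d (p + 1) x -
      (indexDiag d * hankelShift m d (p + 1) x + hankelShift m d (p + 1) x * indexDiag d) +
      (p + 1 + a) • hankelShift m d p x +
      (indexDiag d * hankelShift m d p x + hankelShift m d p x * indexDiag d) := by
  ext i j
  simp only [hankelShift, indexDiag, Matrix.add_apply, Matrix.sub_apply, Matrix.smul_apply,
    diagonal_mul, mul_diagonal, of_apply, smul_eq_mul]
  have := hrec (i + j + p)
  push_cast at this
  simp only [← add_assoc] at this ⊢
  rw [this]
  ring

theorem mul_trace_hankelInv_mul_hankelShift_add_two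
    (hrec : ∀ j : ℕ, x * m (j + 2) x = (x - j - 2) * m (j + 1) x + (j + 1 + a) * m j x) (p : ℕ) :
    x * trace (hankelInv m d x * hankelShift m d (p + 2) x) =
      (x - (p + 2)) * trace (hankelInv m d x * hankelShift m d (p + 1) x) -
      2 * trace (indexDiag d * (hankelInv m d x * hankelShift m d (p + 1) x)) +
      (p + 1 + a) * trace (hankelInv m d x * hankelShift m d p x) +
      2 * trace (indexDiag d * (hankelInv m d x * hankelShift m d p x)) := by
  have hr (q : ℕ) : trace (hankelInv m d x * (hankelShift m d q x * indexDiag d)) =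
      trace (indexDiag d * (hankelInv m d x * hankelShift m d q x)) := by
    rw [← mul_assoc, trace_mul_comm]
  rw [← smul_eq_mul, ← trace_smul, ← Matrix.mul_smul, smul_hankelShift_add_two hrec]
  simp only [mul_add, mul_sub, Matrix.mul_smul, trace_add, trace_sub, trace_smul, smul_eq_mul, hr,
    trace_hankelInv_mul_indexDiag_mul]
  ring

theorem virasoro_two (hx : (hankelShift m d 0 x).det ≠ 0)
    (hrec : ∀ j : ℕ, x * m (j + 2) x = (x - j - 2) * m (j + 1) x + (j + 1 + a) * m j x) :
    x * trace (hankelInv m d x * hankelShift m d 2 x) =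
      (x - 2 * (d + 1)) * trace (companionQ m d x) + (d + 1) * (d + 1 + a) := by
  have h := mul_trace_hankelInv_mul_hankelShift_add_two (d := d) hrec 0
  simp only [zero_add] at h
  rw [← companionQ, hankelInv_mul hx, trace_indexDiag_mul_companionQ hx, mul_one,
    trace_indexDiag, trace_one, Fintype.card_fin] at h
  rw [h]
  push_cast
  ring

theorem virasoro_three (hx : (hankelShift m d 0 x).det ≠ 0)
    (hrec : ∀ j : ℕ, x * m (j + 2) x = (x - j - 2) * m (j + 1) x + (j + 1 + a) * m j x) :
    x * trace (hankelInv m d x * hankelShift m d 3 x) =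
      (x - 2 * (d + 1)) * trace (hankelInv m d x * hankelShift m d 2 x) -
        orthNorm m d x * trace (hankelInv m d x * lastProj d) - trace (companionQ m d x) ^ 2 +
        (2 * (d + 1) + a) * trace (companionQ m d x) := by
  have h := mul_trace_hankelInv_mul_hankelShift_add_two (d := d) hrec 1
  simp only [Nat.reduceAdd] at h
  have hR : trace (indexDiag d * (hankelInv m d x * lastProj d)) =
      d * trace (hankelInv m d x * lastProj d) := by
    rw [← mul_assoc, trace_mul_comm, ← mul_assoc, lastProj_mul_indexDiag, smul_mul_assoc,
      trace_smul, smul_eq_mul, trace_mul_comm]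
  have hQ := trace_indexDiag_mul_companionQ_sq hx
  have h2 : trace (hankelInv m d x * hankelShift m d 2 x) =
      trace (companionQ m d x * companionQ m d x) +
        orthNorm m d x * trace (hankelInv m d x * lastProj d) := by
    rw [hankelInv_mul_hankelShift_two hx, trace_add, trace_smul, smul_eq_mul]
  have h3 : trace (indexDiag d * (hankelInv m d x * hankelShift m d 2 x)) =
      trace (indexDiag d * (companionQ m d x * companionQ m d x)) +
        orthNorm m d x * (d * trace (hankelInv m d x * lastProj d)) := by
    rw [hankelInv_mul_hankelShift_two hx, mul_add, Matrix.mul_smul, trace_add, trace_smul, smul_eq_mul,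
      hR]
  rw [← companionQ, trace_indexDiag_mul_companionQ hx, h3] at h
  rw [h]
  push_cast
  linear_combination (-1 : ℂ) * hQ + (2 * (d : ℂ) - 1) * h2

theorem virasoro_two_two (hx : (hankelShift m d 0 x).det ≠ 0)
    (hrec : ∀ j : ℕ, x * m (j + 2) x = (x - j - 2) * m (j + 1) x + (j + 1 + a) * m j x) :
    x * (trace (hankelInv m d x * hankelShift m d 4 x) -
        trace (hankelInv m d x * hankelShift m d 2 x *
          (hankelInv m d x * hankelShift m d 2 x))) =
      (x - 2 * (d + 1)) * (trace (hankelInv m d x * hankelShift m d 3 x) -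
        trace (hankelInv m d x * hankelShift m d 2 x * companionQ m d x)) +
        2 * trace (hankelInv m d x * hankelShift m d 2 x) -
        2 * trace (hankelInv m d x * hankelShift m d 3 x) := by
  have h := mul_trace_hankelInv_mul_hankelShift_add_two (d := d) hrec 2
  simp only [Nat.reduceAdd] at h
  set K := hankelInv m d x with hK
  set R := indexDiag d with hR
  set Q := companionQ m d x with hQ
  set Y := K * hankelShift m d 2 x with hY
  have hlast : trace (R * (K * hankelShift m d 3 x - Y * Q)) =
      d * trace (K * hankelShift m d 3 x - Y * Q) := by
    have h1 : (K * hankelShift m d 3 x - Y * Q) * lastProj d =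
        K * hankelShift m d 3 x - Y * Q := by
      rw [hY, mul_assoc, ← mul_sub, mul_assoc, hankelShift_succ_sub_mul_lastProj hx 2]
    rw [← h1, ← mul_assoc, trace_mul_comm, ← mul_assoc, hR, lastProj_mul_indexDiag,
      smul_mul_assoc, trace_smul, smul_eq_mul, trace_mul_comm]
  have e1 : trace (Y * (K * (R * hankelShift m d 1 x))) = trace (R * (Y * Q)) := by
    rw [← trace_transpose]
    simp only [hY, hQ, companionQ, ← hK, transpose_mul, hankelShift_transpose]
    rw [hK, hankelInv_transpose, hR, indexDiag_transpose]
    simp only [mul_assoc]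
    rw [trace_mul_comm]
    simp only [mul_assoc]
  have e2 : trace (Y * (K * (hankelShift m d 1 x * R))) = trace (R * (Y * Q)) := by
    rw [trace_mul_comm R, hQ, companionQ, ← hK]
    simp only [mul_assoc]
  have e3 : trace (Y * (K * (R * hankelShift m d 0 x))) = trace (R * Y) := by
    rw [← trace_transpose]
    simp only [hY, transpose_mul, hankelShift_transpose]
    rw [hK, hankelInv_transpose, hR, indexDiag_transpose]
    simp only [mul_assoc]
    rw [trace_mul_comm]
    simp only [mul_assoc]
    rw [hankelInv_mul hx, mul_one]
  have e4 : trace (Y * (K * (hankelShift m d 0 x * R))) = trace (R * Y) := by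
    rw [← mul_assoc K, hK, hankelInv_mul hx, one_mul, trace_mul_comm]
  have hYY : x * trace (Y * Y) = (x - 2) * trace (Y * Q) - 2 * trace (R * (Y * Q)) +
      (1 + a) * trace Y + 2 * trace (R * Y) := by
    have h2 := smul_hankelShift_add_two (d := d) hrec 0
    simp only [zero_add] at h2
    have h3 : x * trace (Y * Y) = trace (Y * (K * (x • hankelShift m d 2 x))) := by
      rw [Matrix.mul_smul, Matrix.mul_smul, trace_smul, smul_eq_mul]
    rw [h3, h2]
    simp only [mul_add, mul_sub, Matrix.mul_smul, trace_add, trace_sub, trace_smul, smul_eq_mul, ← hR,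
      e1, e2, e3, e4]
    rw [← companionQ, hankelInv_mul hx, mul_one]
    push_cast
    ring
  rw [mul_sub, trace_sub, trace_sub] at hlast
  push_cast at h
  linear_combination h - hYY - 2 * hlast

end Recurrence

end Hankel

section MatrixDeriv

open Matrix

variable {n : Type*}

/-- Entrywise differentiability of a matrix valued function of a complex variable. -/
def HasMatrixDerivAt (A : ℂ → Matrix n n ℂ) (A' : Matrix n n ℂ) (x : ℂ) : Prop :=
  ∀ i j, HasDerivAt (fun y => A y i j) (A' i j) x

variable {A B : ℂ → Matrix n n ℂ} {A' B' : Matrix n n ℂ} {x : ℂ}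

theorem HasMatrixDerivAt.unique (hA : HasMatrixDerivAt A A' x) (hA' : HasMatrixDerivAt A B' x) :
    A' = B' := by
  ext i j
  exact (hA i j).unique (hA' i j)

theorem HasMatrixDerivAt.congr_of_eventuallyEq (hA : HasMatrixDerivAt A A' x)
    (h : ∀ᶠ y in nhds x, B y = A y) : HasMatrixDerivAt B A' x := fun i j =>
  (hA i j).congr_of_eventuallyEq (h.mono fun y hy => by simp only [hy])

theorem hasMatrixDerivAt_const (C : Matrix n n ℂ) (x : ℂ) :
    HasMatrixDerivAt (fun _ => C) 0 x := fun i j => hasDerivAt_const x (C i j)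

theorem HasMatrixDerivAt.add (hA : HasMatrixDerivAt A A' x) (hB : HasMatrixDerivAt B B' x) :
    HasMatrixDerivAt (fun y => A y + B y) (A' + B') x := fun i j => (hA i j).add (hB i j)

theorem HasMatrixDerivAt.smul {f : ℂ → ℂ} {f' : ℂ} (hf : HasDerivAt f f' x)
    (hA : HasMatrixDerivAt A A' x) :
    HasMatrixDerivAt (fun y => f y • A y) (f' • A x + f x • A') x :=
  fun i j => hf.mul (hA i j)

variable [Fintype n]

theorem HasMatrixDerivAt.mul (hA : HasMatrixDerivAt A A' x) (hB : HasMatrixDerivAt B B' x) :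
    HasMatrixDerivAt (fun y => A y * B y) (A' * B x + A x * B') x := by
  intro i j
  simp only [mul_apply, Matrix.add_apply, ← Finset.sum_add_distrib]
  exact HasDerivAt.fun_sum fun k _ => (hA i k).mul (hB k j)

theorem HasMatrixDerivAt.trace (hA : HasMatrixDerivAt A A' x) :
    HasDerivAt (fun y => (A y).trace) A'.trace x :=
  HasDerivAt.fun_sum fun i _ => hA i i

variable [DecidableEq n]

theorem HasMatrixDerivAt.det (hA : HasMatrixDerivAt A A' x) :
    HasDerivAt (fun y => (A y).det) ((A x).adjugate * A').trace x := by
  have h : HasDerivAt (fun y => (A y).det) (∑ σ : Equiv.Perm n, ((Equiv.Perm.sign σ : ℤ) : ℂ) *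
      ∑ i, (∏ j ∈ Finset.univ.erase i, A x (σ j) j) • A' (σ i) i) x := by
    simp only [det_apply']
    exact HasDerivAt.fun_sum fun σ _ =>
      (HasDerivAt.fun_finsetProd fun i _ => hA (σ i) i).const_mul _
  refine h.congr_deriv ?_
  simp only [Finset.mul_sum]
  rw [Finset.sum_comm]
  refine Finset.sum_congr rfl fun i _ => ?_
  have : ((A x).adjugate * A') i i = ((A x).updateCol i fun k => A' k i).det := by
    rw [← cramer_apply, cramer_eq_adjugate_mulVec]
    rfl
  rw [diag_apply, this, det_apply']
  refine Finset.sum_congr rfl fun σ _ => ?_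
  rw [← Finset.prod_erase_mul _ _ (Finset.mem_univ i), updateCol_self, smul_eq_mul]
  congr 2
  refine Finset.prod_congr rfl fun j hj => ?_
  rw [updateCol_ne (Finset.ne_of_mem_erase hj)]

theorem HasMatrixDerivAt.inv (hA : HasMatrixDerivAt A A' x) (hx : (A x).det ≠ 0) :
    HasMatrixDerivAt (fun y => (A y)⁻¹) (-((A x)⁻¹ * A' * (A x)⁻¹)) x := by
  have hdiff : ∀ i j, DifferentiableAt ℂ (fun y => (A y)⁻¹ i j) x := by
    intro i j
    have hadj : DifferentiableAt ℂ (fun y => (A y).adjugate i j) x := by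
      simp only [adjugate_apply]
      have : HasMatrixDerivAt (fun y => (A y).updateRow j (Pi.single i 1)) (A'.updateRow j 0) x := by
        intro k l
        by_cases hk : k = j
        · subst hk
          simp only [updateRow_self]
          exact hasDerivAt_const _ _
        · simp only [updateRow_ne hk]
          exact hA k l
      exact this.det.differentiableAt
    simp only [inv_def, Ring.inverse_eq_inv', Matrix.smul_apply, smul_eq_mul]
    exact (hA.det.differentiableAt.inv hx).mul hadj
  have hK : HasMatrixDerivAt (fun y => (A y)⁻¹)
      (Matrix.of fun i j => deriv (fun y => (A y)⁻¹ i j) x) x := fun i j => (hdiff i j).hasDerivAt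
  have hne : ∀ᶠ y in nhds x, (A y).det ≠ 0 := hA.det.continuousAt.eventually_ne hx
  have h1 : HasMatrixDerivAt (fun y => (A y)⁻¹ * A y) 0 x :=
    (hasMatrixDerivAt_const 1 x).congr_of_eventuallyEq
      (hne.mono fun y hy => nonsing_inv_mul _ hy.isUnit)
  have h2 := (hK.mul hA).unique h1
  have h3 := congrArg (· * (A x)⁻¹) (eq_neg_of_add_eq_zero_left h2)
  simp only [mul_assoc, mul_nonsing_inv _ hx.isUnit, mul_one, neg_mul] at h3
  rw [h3, ← mul_assoc] at hK
  exact hK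

end MatrixDeriv

section HankelDeriv

open Matrix

variable {m : ℕ → ℂ → ℂ} {d : ℕ} {x : ℂ}

theorem hasMatrixDerivAt_hankelShift
    (hm : ∀ j x, HasDerivAt (m j) (m (j + 1) x) x) (p : ℕ) (x : ℂ) :
    HasMatrixDerivAt (hankelShift m d p) (hankelShift m d (p + 1) x) x := fun _ _ => hm _ x

theorem differentiable_det_hankelShift
    (hm : ∀ j x, HasDerivAt (m j) (m (j + 1) x) x) (p : ℕ) :
    Differentiable ℂ fun x => (hankelShift m d p x).det := fun x =>
  (hasMatrixDerivAt_hankelShift hm p x).det.differentiableAt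

theorem isOpen_det_hankelShift_ne_zero
    (hm : ∀ j x, HasDerivAt (m j) (m (j + 1) x) x) (p : ℕ) :
    IsOpen {x | (hankelShift m d p x).det ≠ 0} :=
  isOpen_ne_fun (differentiable_det_hankelShift hm p).continuous continuous_const

theorem eventually_det_hankelShift_ne_zero
    (hm : ∀ j x, HasDerivAt (m j) (m (j + 1) x) x) (hx : (hankelShift m d 0 x).det ≠ 0) :
    ∀ᶠ y in nhds x, (hankelShift m d 0 y).det ≠ 0 :=
  (isOpen_det_hankelShift_ne_zero hm 0).mem_nhds hx

theorem hasDerivAt_det_hankelShift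
    (hm : ∀ j x, HasDerivAt (m j) (m (j + 1) x) x) (hx : (hankelShift m d 0 x).det ≠ 0) :
    HasDerivAt (fun x => (hankelShift m d 0 x).det)
      ((hankelShift m d 0 x).det * trace (companionQ m d x)) x := by
  refine (hasMatrixDerivAt_hankelShift hm 0 x).det.congr_deriv ?_
  rw [companionQ, hankelInv, inv_def, Ring.inverse_eq_inv', smul_mul_assoc, trace_smul,
    smul_eq_mul, mul_inv_cancel_left₀ hx]

theorem hasMatrixDerivAt_hankelInv
    (hm : ∀ j x, HasDerivAt (m j) (m (j + 1) x) x) (hx : (hankelShift m d 0 x).det ≠ 0) :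
    HasMatrixDerivAt (hankelInv m d) (-(companionQ m d x * hankelInv m d x)) x :=
  (hasMatrixDerivAt_hankelShift hm 0 x).inv hx

theorem hasMatrixDerivAt_hankelInv_mul_hankelShift
    (hm : ∀ j x, HasDerivAt (m j) (m (j + 1) x) x) (hx : (hankelShift m d 0 x).det ≠ 0) (p : ℕ) :
    HasMatrixDerivAt (fun y => hankelInv m d y * hankelShift m d p y)
      (hankelInv m d x * hankelShift m d (p + 1) x -
        companionQ m d x * (hankelInv m d x * hankelShift m d p x)) x := by
  have h := (hasMatrixDerivAt_hankelInv hm hx).mul (hasMatrixDerivAt_hankelShift hm p x)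
  rwa [neg_mul, neg_add_eq_sub, mul_assoc] at h

theorem hasDerivAt_trace_hankelInv_mul_hankelShift
    (hm : ∀ j x, HasDerivAt (m j) (m (j + 1) x) x) (hx : (hankelShift m d 0 x).det ≠ 0) (p : ℕ) :
    HasDerivAt (fun y => trace (hankelInv m d y * hankelShift m d p y))
      (trace (hankelInv m d x * hankelShift m d (p + 1) x) -
        trace (hankelInv m d x * hankelShift m d p x * companionQ m d x)) x := by
  have h := (hasMatrixDerivAt_hankelInv_mul_hankelShift hm hx p).trace
  rwa [trace_sub, trace_mul_comm (companionQ m d x)] at h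

theorem hasMatrixDerivAt_companionQ
    (hm : ∀ j x, HasDerivAt (m j) (m (j + 1) x) x) (hx : (hankelShift m d 0 x).det ≠ 0) :
    HasMatrixDerivAt (companionQ m d) (orthNorm m d x • (hankelInv m d x * lastProj d)) x := by
  have h := hasMatrixDerivAt_hankelInv_mul_hankelShift hm hx 1
  rwa [hankelInv_mul_hankelShift_two hx, ← companionQ, add_sub_cancel_left] at h

theorem hasDerivAt_trace_companionQ
    (hm : ∀ j x, HasDerivAt (m j) (m (j + 1) x) x) (hx : (hankelShift m d 0 x).det ≠ 0) :
    HasDerivAt (fun y => trace (companionQ m d y))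
      (orthNorm m d x * trace (hankelInv m d x * lastProj d)) x := by
  have h := (hasMatrixDerivAt_companionQ hm hx).trace
  rwa [trace_smul, smul_eq_mul] at h

theorem hasDerivAt_trace_hankelInv_mul_lastProj
    (hm : ∀ j x, HasDerivAt (m j) (m (j + 1) x) x) (hx : (hankelShift m d 0 x).det ≠ 0) :
    HasDerivAt (fun y => trace (hankelInv m d y * lastProj d))
      (-trace (companionQ m d x * hankelInv m d x * lastProj d)) x := by
  have h := ((hasMatrixDerivAt_hankelInv hm hx).mul (hasMatrixDerivAt_const (lastProj d) x)).trace
  rwa [mul_zero, add_zero, neg_mul, trace_neg] at h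

theorem hasDerivAt_trace_companionQ_mul_hankelInv_mul_lastProj
    (hm : ∀ j x, HasDerivAt (m j) (m (j + 1) x) x)
    (hx : (hankelShift m d 0 x).det ≠ 0) :
    HasDerivAt (fun y => trace (companionQ m d y * hankelInv m d y * lastProj d))
      (orthNorm m d x * trace (hankelInv m d x * lastProj d) ^ 2 -
        trace (companionQ m d x * companionQ m d x * hankelInv m d x * lastProj d)) x := by
  have h := (((hasMatrixDerivAt_companionQ hm hx).mul (hasMatrixDerivAt_hankelInv hm hx)).mul
    (hasMatrixDerivAt_const (lastProj d) x)).trace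
  refine h.congr_deriv ?_
  have h1 : hankelInv m d x * lastProj d * hankelInv m d x * lastProj d =
      trace (hankelInv m d x * lastProj d) • (hankelInv m d x * lastProj d) := by
    rw [mul_assoc, mul_assoc, ← mul_assoc (lastProj d), lastProj_mul_mul_lastProj_eq_trace,
      Matrix.mul_smul]
  rw [mul_zero, add_zero, add_mul, smul_mul_assoc, smul_mul_assoc, h1, trace_add, trace_smul,
    trace_smul, mul_neg, neg_mul, trace_neg, smul_eq_mul, smul_eq_mul, mul_assoc (companionQ m d x)
    (companionQ m d x)]
  ring

theorem differentiableAt_orthNorm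
    (hm : ∀ j x, HasDerivAt (m j) (m (j + 1) x) x) (hx : (hankelShift m d 0 x).det ≠ 0) :
    DifferentiableAt ℂ (orthNorm m d) x :=
  ((hasMatrixDerivAt_hankelShift hm 2 x _ _).sub
    (((hasMatrixDerivAt_hankelShift hm 1 x).mul (hasMatrixDerivAt_companionQ hm hx)) _ _)
    ).differentiableAt

theorem analyticAt_orthNorm
    (hm : ∀ j x, HasDerivAt (m j) (m (j + 1) x) x) (hx : (hankelShift m d 0 x).det ≠ 0) :
    AnalyticAt ℂ (orthNorm m d) x :=
  DifferentiableOn.analyticAt (s := {x | (hankelShift m d 0 x).det ≠ 0})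
    (fun _ hy => (differentiableAt_orthNorm hm hy).differentiableWithinAt)
    (eventually_det_hankelShift_ne_zero hm hx)

theorem hankelInv_mul_hankelShift_three
    (hm : ∀ j x, HasDerivAt (m j) (m (j + 1) x) x) (hx : (hankelShift m d 0 x).det ≠ 0) :
    hankelInv m d x * hankelShift m d 3 x =
      hankelInv m d x * hankelShift m d 2 x * companionQ m d x +
        orthNorm m d x • (companionQ m d x * hankelInv m d x * lastProj d) +
        deriv (orthNorm m d) x • (hankelInv m d x * lastProj d) := by
  have h1 := ((hasMatrixDerivAt_hankelShift hm 1 x).mul (hasMatrixDerivAt_companionQ hm hx)).add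
    (HasMatrixDerivAt.smul (differentiableAt_orthNorm hm hx).hasDerivAt
      (hasMatrixDerivAt_const (lastProj d) x))
  have h2 := (hasMatrixDerivAt_hankelShift hm 2 x).unique (h1.congr_of_eventuallyEq
    ((eventually_det_hankelShift_ne_zero hm hx).mono fun y hy => hankelShift_two_eq hy))
  rw [h2, smul_zero, add_zero]
  simp only [mul_add, Matrix.mul_smul, companionQ, mul_assoc]

theorem trace_hankelInv_mul_hankelShift_three
    (hm : ∀ j x, HasDerivAt (m j) (m (j + 1) x) x) (hx : (hankelShift m d 0 x).det ≠ 0) :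
    trace (hankelInv m d x * hankelShift m d 3 x) =
      trace (companionQ m d x * companionQ m d x * companionQ m d x) +
        2 * (orthNorm m d x * trace (companionQ m d x * hankelInv m d x * lastProj d)) +
        deriv (orthNorm m d) x * trace (hankelInv m d x * lastProj d) := by
  rw [hankelInv_mul_hankelShift_three hm hx, hankelInv_mul_hankelShift_two hx]
  simp only [add_mul, smul_mul_assoc, trace_add, trace_smul, smul_eq_mul]
  rw [trace_mul_comm (hankelInv m d x * lastProj d), mul_assoc (companionQ m d x) (hankelInv m d x)]
  ring

theorem hasDerivAt_trace_companionQ_cube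
    (hm : ∀ j x, HasDerivAt (m j) (m (j + 1) x) x) (hx : (hankelShift m d 0 x).det ≠ 0) :
    HasDerivAt (fun y => trace (companionQ m d y * companionQ m d y * companionQ m d y))
      (3 * (orthNorm m d x *
        trace (companionQ m d x * companionQ m d x * hankelInv m d x * lastProj d))) x := by
  have hQ := hasMatrixDerivAt_companionQ hm hx
  refine ((hQ.mul hQ).mul hQ).trace.congr_deriv ?_
  rw [mul_assoc (companionQ m d x * companionQ m d x)]
  generalize companionQ m d x = Q
  generalize hankelInv m d x * lastProj d = B
  have e1 : trace (B * Q * Q) = trace (Q * Q * B) := by rw [mul_assoc, trace_mul_comm]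
  have e2 : trace (Q * B * Q) = trace (Q * Q * B) := by rw [trace_mul_comm, mul_assoc]
  simp only [add_mul, smul_mul_assoc, Matrix.mul_smul, trace_add, trace_smul, smul_eq_mul, e1, e2]
  ring

theorem deriv_trace_hankelInv_mul_hankelShift_three
    (hm : ∀ j x, HasDerivAt (m j) (m (j + 1) x) x) (hx : (hankelShift m d 0 x).det ≠ 0) :
    deriv (fun y => trace (hankelInv m d y * hankelShift m d 3 y)) x =
      3 * (orthNorm m d x *
        trace (companionQ m d x * companionQ m d x * hankelInv m d x * lastProj d)) +
      2 * (deriv (orthNorm m d) x * trace (companionQ m d x * hankelInv m d x * lastProj d) +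
        orthNorm m d x * (orthNorm m d x * trace (hankelInv m d x * lastProj d) ^ 2 -
        trace (companionQ m d x * companionQ m d x * hankelInv m d x * lastProj d))) +
      (deriv (deriv (orthNorm m d)) x * trace (hankelInv m d x * lastProj d) +
        deriv (orthNorm m d) x * -trace (companionQ m d x * hankelInv m d x * lastProj d)) := by
  have hh := (differentiableAt_orthNorm hm hx).hasDerivAt
  have hh' := (analyticAt_orthNorm hm hx).deriv.differentiableAt.hasDerivAt
  have hsum := ((hasDerivAt_trace_companionQ_cube hm hx).fun_add ((hh.fun_mul
    (hasDerivAt_trace_companionQ_mul_hankelInv_mul_lastProj hm hx)).const_mul 2)).fun_add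
    (hh'.fun_mul (hasDerivAt_trace_hankelInv_mul_lastProj hm hx))
  rw [← hsum.deriv]
  exact Filter.EventuallyEq.deriv_eq ((eventually_det_hankelShift_ne_zero hm hx).mono fun y hy =>
    trace_hankelInv_mul_hankelShift_three hm hy)

theorem deriv_deriv_trace_companionQ
    (hm : ∀ j x, HasDerivAt (m j) (m (j + 1) x) x) (hx : (hankelShift m d 0 x).det ≠ 0) :
    deriv (deriv fun y => trace (companionQ m d y)) x =
      deriv (orthNorm m d) x * trace (hankelInv m d x * lastProj d) -
        orthNorm m d x * trace (companionQ m d x * hankelInv m d x * lastProj d) := by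
  refine HasDerivAt.deriv ((((differentiableAt_orthNorm hm hx).hasDerivAt.mul
    (hasDerivAt_trace_hankelInv_mul_lastProj hm hx)).congr_of_eventuallyEq
    ((eventually_det_hankelShift_ne_zero hm hx).mono fun y hy =>
      (hasDerivAt_trace_companionQ hm hy).deriv)).congr_deriv ?_)
  ring

theorem deriv_deriv_deriv_trace_companionQ
    (hm : ∀ j x, HasDerivAt (m j) (m (j + 1) x) x) (hx : (hankelShift m d 0 x).det ≠ 0) :
    deriv (deriv (deriv fun y => trace (companionQ m d y))) x =
      deriv (deriv (orthNorm m d)) x * trace (hankelInv m d x * lastProj d) -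
        2 * (deriv (orthNorm m d) x * trace (companionQ m d x * hankelInv m d x * lastProj d)) -
        orthNorm m d x * (orthNorm m d x * trace (hankelInv m d x * lastProj d) ^ 2 -
        trace (companionQ m d x * companionQ m d x * hankelInv m d x * lastProj d)) := by
  have hh := (differentiableAt_orthNorm hm hx).hasDerivAt
  have hh' := (analyticAt_orthNorm hm hx).deriv.differentiableAt.hasDerivAt
  refine HasDerivAt.deriv ((((hh'.mul (hasDerivAt_trace_hankelInv_mul_lastProj hm hx)).sub
    (hh.mul (hasDerivAt_trace_companionQ_mul_hankelInv_mul_lastProj hm hx))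
    ).congr_of_eventuallyEq ((eventually_det_hankelShift_ne_zero hm hx).mono fun y hy =>
      deriv_deriv_trace_companionQ hm hy)).congr_deriv ?_)
  ring

/-- The Kadomtsev–Petviashvili equation for the logarithmic derivative of a Hankel determinant. -/
theorem kadomtsev_petviashvili_hankel
    (hm : ∀ j x, HasDerivAt (m j) (m (j + 1) x) x) (hx : (hankelShift m d 0 x).det ≠ 0) :
    deriv (deriv (deriv fun y => trace (companionQ m d y))) x +
      6 * deriv (fun y => trace (companionQ m d y)) x ^ 2 -
      4 * deriv (fun y => trace (hankelInv m d y * hankelShift m d 3 y)) x +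
      3 * (trace (hankelInv m d x * hankelShift m d 4 x) -
        trace (hankelInv m d x * hankelShift m d 2 x *
          (hankelInv m d x * hankelShift m d 2 x))) = 0 := by
  have h3 := (hasDerivAt_trace_hankelInv_mul_hankelShift hm hx 3).deriv
  have h3' := deriv_trace_hankelInv_mul_hankelShift_three hm hx
  rw [deriv_deriv_deriv_trace_companionQ hm hx, (hasDerivAt_trace_companionQ hm hx).deriv]
  have h4 : trace (hankelInv m d x * hankelShift m d 3 x * companionQ m d x) -
      trace (hankelInv m d x * hankelShift m d 2 x *
        (hankelInv m d x * hankelShift m d 2 x)) =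
      deriv (orthNorm m d) x * trace (companionQ m d x * hankelInv m d x * lastProj d) -
        orthNorm m d x ^ 2 * trace (hankelInv m d x * lastProj d) ^ 2 := by
    rw [hankelInv_mul_hankelShift_three hm hx, hankelInv_mul_hankelShift_two hx]
    set Q := companionQ m d x
    rw [mul_assoc Q (hankelInv m d x)]
    set B := hankelInv m d x * lastProj d with hB
    have e1 : trace (B * Q * Q) = trace (Q * Q * B) := by rw [mul_assoc, trace_mul_comm]
    have e2 : trace (Q * B * Q) = trace (Q * Q * B) := by rw [trace_mul_comm, mul_assoc]
    have e3 : trace (B * (Q * Q)) = trace (Q * Q * B) := trace_mul_comm _ _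
    have e4 : B * B = trace B • B := by
      rw [hB, mul_assoc, ← mul_assoc (lastProj d), lastProj_mul_mul_lastProj_eq_trace,
        Matrix.mul_smul]
    have e5 : trace (B * Q) = trace (Q * B) := trace_mul_comm _ _
    have e6 : Q * Q * Q * Q = Q * Q * (Q * Q) := mul_assoc _ _ _
    simp only [add_mul, mul_add, smul_mul_assoc, Matrix.mul_smul, trace_add, trace_smul,
      smul_eq_mul, e1, e2, e3, e4, e5, e6]
    ring
  simp only [Nat.reduceAdd] at h3
  linear_combination (-3 : ℂ) * h3 - h3' + 3 * h4

end HankelDeriv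

section Nonvanishing

open Matrix

theorem det_hankel_ne_zero_of_recurrence {μ : ℕ → ℂ} {a n : ℕ} (hn : n ≤ a) (h0 : μ 0 ≠ 0)
    (hμ : ∀ j : ℕ, (j + 2) * μ (j + 1) = (j + 1 + a) * μ j) :
    (Matrix.of fun i j : Fin n => μ (i + j)).det ≠ 0 := by
  have hne (i : ℕ) : μ i ≠ 0 := by
    induction i with
    | zero => exact h0
    | succ i ih =>
      intro h
      have := hμ i
      rw [h, mul_zero, eq_comm, mul_eq_zero] at this
      exact this.elim (fun h => by norm_cast at h; omega) ih
  have hprod (i j : ℕ) : (∏ l ∈ Finset.range j, ((i : ℂ) + (l + 2))) * μ (i + j) =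
      (∏ l ∈ Finset.range j, ((i : ℂ) + (a + l + 1))) * μ i := by
    induction j with
    | zero => simp
    | succ j ih =>
      rw [Finset.prod_range_succ, Finset.prod_range_succ]
      have := hμ (i + j)
      push_cast at this
      rw [← add_assoc i j 1]
      linear_combination ((i : ℂ) + (a + j + 1)) * ih +
        (∏ l ∈ Finset.range j, ((i : ℂ) + (l + 2))) * this
  intro hdet
  obtain ⟨v, hv, hMv⟩ := Matrix.exists_mulVec_eq_zero_iff.2 hdet
  apply hv
  set P : Polynomial ℂ := ∑ j : Fin n, Polynomial.C (v j) *
    ((∏ l ∈ Finset.range j, (Polynomial.X + Polynomial.C ((a : ℂ) + l + 1))) *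
      ∏ l ∈ Finset.Ico (j : ℕ) (n - 1), (Polynomial.X + Polynomial.C ((l : ℂ) + 2))) with hP
  have heval (z : ℂ) : P.eval z = ∑ j : Fin n, v j *
      ((∏ l ∈ Finset.range j, (z + (a + l + 1))) *
        ∏ l ∈ Finset.Ico (j : ℕ) (n - 1), (z + (l + 2))) := by
    simp [hP, Polynomial.eval_finsetSum, Polynomial.eval_prod]
  have hroot (i : Fin n) : P.eval ((i : ℕ) : ℂ) = 0 := by
    have h1 := congrFun hMv i
    simp only [mulVec, dotProduct, of_apply, Pi.zero_apply] at h1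
    have h2 : P.eval ((i : ℕ) : ℂ) * μ i =
        (∏ l ∈ Finset.range (n - 1), (((i : ℕ) : ℂ) + (l + 2))) *
          ∑ j : Fin n, μ (i + j) * v j := by
      rw [heval, Finset.sum_mul, Finset.mul_sum]
      refine Finset.sum_congr rfl fun j _ => ?_
      rw [← Finset.prod_range_mul_prod_Ico _ (show (j : ℕ) ≤ n - 1 by omega)]
      linear_combination -(v j * ∏ l ∈ Finset.Ico (j : ℕ) (n - 1), (((i : ℕ) : ℂ) + (l + 2))) *
        hprod i j
    rw [h1, mul_zero] at h2
    exact (mul_eq_zero.1 h2).resolve_right (hne i)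
  have hP0 : P = 0 := by
    rcases Nat.eq_zero_or_pos n with rfl | hpos
    · simp [hP]
    refine Polynomial.eq_zero_of_natDegree_lt_card_of_eval_eq_zero P
      (f := fun i : Fin n => ((i : ℕ) : ℂ)) (fun i j h => Fin.ext (Nat.cast_injective (R := ℂ) h)) hroot ?_
    rw [Fintype.card_fin]
    refine lt_of_le_of_lt (Polynomial.natDegree_sum_le_of_forall_le (n := n - 1) _ _
      fun j _ => ?_) (by omega)
    refine (Polynomial.natDegree_C_mul_le _ _).trans (Polynomial.natDegree_mul_le.trans ?_)
    refine (add_le_add (Polynomial.natDegree_prod_le _ _) (Polynomial.natDegree_prod_le _ _)).trans ?_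
    simp only [Polynomial.natDegree_X_add_C, Finset.sum_const, Finset.card_range, Nat.card_Ico,
      smul_eq_mul, mul_one]
    omega
  have hv0 (j : ℕ) (hj : j < n) : v ⟨j, hj⟩ = 0 := by
    induction j using Nat.strong_induction_on with
    | _ j ih =>
      have h := heval (-(a + j + 1))
      rw [hP0, Polynomial.eval_zero, Finset.sum_eq_single (⟨j, hj⟩ : Fin n)] at h
      · refine (mul_eq_zero.1 h.symm).resolve_right (mul_ne_zero ?_ ?_)
        · refine Finset.prod_ne_zero_iff.2 fun l hl => ?_
          have hlj : l < j := Finset.mem_range.1 hl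
          intro h'
          have : (l : ℂ) = j := by linear_combination h'
          exact hlj.ne (by exact_mod_cast this)
        · refine Finset.prod_ne_zero_iff.2 fun l hl => ?_
          have hlj := Finset.mem_Ico.1 hl
          intro h'
          have : (l : ℂ) + 1 = a + j := by linear_combination h'
          have : l + 1 = a + j := by exact_mod_cast this
          omega
      · intro i _ hij
        rcases lt_trichotomy (i : ℕ) j with hlt | heq | hgt
        · rw [ih i hlt i.2, zero_mul]
        · exact absurd (Fin.ext heq) hij
        · rw [Finset.prod_eq_zero (Finset.mem_range.2 hgt) (by ring), zero_mul, mul_zero]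
      · simp
  funext j
  exact hv0 j j.2

end Nonvanishing

section BasisChange

open Matrix

variable {r : ℝ}

theorem expMoment_recurrence
    (hr0 : 0 < r) (hr1 : r < 1) (a : ℕ) (x : ℂ) (j : ℕ) :
    x * expMoment r (j + 2 + 2) (a + 1) x =
      (x - j - 2) * expMoment r (j + 1 + 2) (a + 1) x +
        (j + 1 + (a + 1 : ℕ)) * expMoment r (j + 2) (a + 1) x := by
  have h := expMoment_integration_by_parts hr0 hr1 (j + 2) a x
  have h1 := expMoment_succ_sub hr0 hr1 (j + 3) a x
  have h2 := expMoment_succ_sub hr0 hr1 (j + 2) a x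
  push_cast at h ⊢
  rw [show j + 1 + 2 = j + 3 by ring]
  linear_combination h + x * h1 + ((j : ℂ) + 2) * h2

theorem weightW_moment
    (hr0 : 0 < r) (hr1 : r < 1) {N k p : ℕ} (hp : p ≤ N + k) (x : ℂ) :
    (∮ s in C(0, r), weightW N k x s * s ^ p) = expMoment r (2 * k) (N + k - p) x := by
  refine circleIntegral.integral_congr hr0.le fun s hs => ?_
  have h0 := ne_zero_of_mem_sphere_zero hr0 hs
  have h1 := one_sub_ne_zero_of_mem_sphere hr1 hs
  obtain ⟨q, hq⟩ := Nat.exists_eq_add_of_le hp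
  simp only [weightW, hq, Nat.add_sub_cancel_left, pow_add]
  field_simp

theorem expMoment_sub_eq_sum
    (hr0 : 0 < r) (hr1 : r < 1) {N k : ℕ} (i j : Fin k) (x : ℂ) :
    expMoment r (2 * k - (i + j)) (N + k) x = ∑ l : Fin k, ∑ l' : Fin k,
      ((-1) ^ (l : ℕ) * ((i : ℕ).choose l : ℂ)) * ((∮ s in C(0, r), weightW N k x s *
        s ^ ((l : ℕ) + l')) * ((-1) ^ (l' : ℕ) * ((j : ℕ).choose l' : ℂ))) := by
  have hpow (i : Fin k) (s : ℂ) : (1 - s) ^ (i : ℕ) =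
      ∑ l : Fin k, ((-1) ^ (l : ℕ) * ((i : ℕ).choose l : ℂ)) * s ^ (l : ℕ) := by
    rw [Fin.sum_univ_eq_sum_range (fun l => ((-1) ^ l * ((i : ℕ).choose l : ℂ)) * s ^ l) k,
      sub_eq_neg_add, add_pow]
    refine Finset.sum_subset_zero_on_sdiff (Finset.range_subset_range.2 i.2) (fun l hl => ?_)
      fun l _ => ?_
    · rw [Nat.choose_eq_zero_of_lt (by simp at hl; omega)]
      simp
    · rw [one_pow, mul_one, neg_pow]
      ring
  have hci (c : ℂ) (p : ℕ) :
      CircleIntegrable (fun s => c * (weightW N k x s * s ^ p)) 0 r := by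
    refine ContinuousOn.circleIntegrable hr0.le (continuousOn_const.mul (ContinuousOn.mul ?_
      (by fun_prop)))
    exact continuousOn_expMoment_integrand hr0 hr1 _ _ x
  have hsum : ∀ s, weightW N k x s * ((1 - s) ^ (i : ℕ) * (1 - s) ^ (j : ℕ)) =
      ∑ q : Fin k × Fin k, (((-1) ^ (q.1 : ℕ) * ((i : ℕ).choose q.1 : ℂ)) *
        ((-1) ^ (q.2 : ℕ) * ((j : ℕ).choose q.2 : ℂ))) *
          (weightW N k x s * s ^ ((q.1 : ℕ) + q.2)) := by
    intro s
    rw [hpow, hpow, Finset.sum_mul_sum, Finset.mul_sum, Fintype.sum_prod_type]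
    refine Finset.sum_congr rfl fun l _ => ?_
    rw [Finset.mul_sum]
    refine Finset.sum_congr rfl fun l' _ => ?_
    rw [pow_add]
    ring
  have hleft : expMoment r (2 * k - (i + j)) (N + k) x =
      ∮ s in C(0, r), weightW N k x s * ((1 - s) ^ (i : ℕ) * (1 - s) ^ (j : ℕ)) := by
    refine circleIntegral.integral_congr hr0.le fun s hs => ?_
    have h0 := ne_zero_of_mem_sphere_zero hr0 hs
    have h1 := one_sub_ne_zero_of_mem_sphere hr1 hs
    obtain ⟨q, hq⟩ := Nat.exists_eq_add_of_le (show (i : ℕ) + j ≤ 2 * k by omega)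
    simp only [weightW, hq, Nat.add_sub_cancel_left, pow_add]
    field_simp
  rw [hleft]
  simp only [hsum]
  rw [circleIntegral.integral_fun_sum fun q _ => hci _ _, Fintype.sum_prod_type]
  refine Finset.sum_congr rfl fun l _ => Finset.sum_congr rfl fun l' _ => ?_
  rw [circleIntegral.integral_const_mul]
  ring

theorem hankelDet_weightW_eq
    (hr0 : 0 < r) (hr1 : r < 1) (N d : ℕ) (x : ℂ) :
    hankelDet r (d + 1) (weightW N (d + 1) x) =
      (hankelShift (fun j => expMoment r (j + 2) (N + (d + 1))) d 0 x).det := by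
  set T : Matrix (Fin (d + 1)) (Fin (d + 1)) ℂ :=
    Matrix.of fun i l => (-1) ^ (l : ℕ) * ((i : ℕ).choose l : ℂ) with hT
  set M : Matrix (Fin (d + 1)) (Fin (d + 1)) ℂ := Matrix.of fun i j =>
    ∮ s in C(0, r), weightW N (d + 1) x s * s ^ ((i : ℕ) + (j : ℕ)) with hM
  have hdetT : T.det * T.det = 1 := by
    rw [det_of_isLowerTriangular T, ← Finset.prod_mul_distrib]
    · refine Finset.prod_eq_one fun i _ => ?_
      simp [hT, ← mul_pow]
    · intro i l hil
      have : (i : ℕ) < l := hil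
      simp [hT, Nat.choose_eq_zero_of_lt this]
  have hTMT : T * (M * Tᵀ) = Matrix.of fun i j : Fin (d + 1) =>
      expMoment r (2 * (d + 1) - (i + j)) (N + (d + 1)) x := by
    ext i j
    rw [of_apply, expMoment_sub_eq_sum hr0 hr1]
    simp only [mul_apply, Finset.mul_sum]
    rfl
  have hrev : hankelShift (fun j => expMoment r (j + 2) (N + (d + 1))) d 0 x =
      (T * (M * Tᵀ)).submatrix Fin.revPerm Fin.revPerm := by
    rw [hTMT]
    ext i j
    simp only [hankelShift, of_apply, submatrix_apply, Fin.revPerm_apply, Fin.val_rev]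
    congr 1
    omega
  rw [hrev, det_submatrix_equiv_self, det_mul, det_mul, det_transpose, mul_left_comm, hdetT,
    mul_one]
  rfl

end BasisChange

section Painleve

open Matrix

theorem isPreconnected_ne_zero_of_differentiable {H : ℂ → ℂ} (hH : Differentiable ℂ H) {z : ℂ}
    (hz : H z ≠ 0) : IsPreconnected {x | H x ≠ 0} := by
  have hcod := (mem_codiscrete'.1
    (AnalyticOnNhd.preimage_zero_mem_codiscrete (fun x _ => hH.analyticAt x) hz)).2
  have hcount := ((HereditarilyLindelofSpace.isLindelof _).countable_of_isDiscrete hcod)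
  have h := (hcount.isConnected_compl_of_one_lt_rank
    (by simp only [Complex.rank_real_complex, Nat.one_lt_ofNat])).isPreconnected
  rwa [compl_compl] at h

/-- The derivative of the `σ`-Painlevé V expression of `σ = x T - k x - N k` is a multiple of the
Kadomtsev–Petviashvili expression, once the Virasoro constraints hold. -/
theorem deriv_sigmaForm_eq_zero {x k N T T₁ T₂ T₃ u₂ v₂ u₃ v₃ u₂₂ : ℂ} (hx : x ≠ 0)
    (h₂ : x * u₂ = (x - 2 * k) * T + k * (N + 2 * k))
    (h₂' : u₂ + x * v₂ = T + (x - 2 * k) * T₁)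
    (h₃ : x * u₃ = (x - 2 * k) * u₂ - T₁ - T ^ 2 + (3 * k + N) * T)
    (h₃' : u₃ + x * v₃ = u₂ + (x - 2 * k) * v₂ - T₂ - 2 * T * T₁ + (3 * k + N) * T₁)
    (h₂₂ : x * u₂₂ = (x - 2 * k) * v₂ + 2 * u₂ - 2 * u₃)
    (hKP : T₃ + 6 * T₁ ^ 2 - 4 * v₃ + 3 * u₂₂ = 0)
    {s s₁ s₂ s₃ : ℂ} (hs : s = x * T - k * x - N * k) (hs₁ : s₁ = T + x * T₁ - k)
    (hs₂ : s₂ = 2 * T₁ + x * T₂) (hs₃ : s₃ = 3 * T₂ + x * T₃) :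
    2 * (x * s₂) * (s₂ + x * s₃) -
      2 * (s - x * s₁ + 2 * s₁ ^ 2 - 2 * N * s₁) * (-x * s₂ + 4 * s₁ * s₂ - 2 * N * s₂) +
      4 * (s₂ * (-N + s₁) * (-k - N + s₁) * (k + s₁) + s₁ * s₂ * (-k - N + s₁) * (k + s₁) +
        s₁ * (-N + s₁) * s₂ * (k + s₁) + s₁ * (-N + s₁) * (-k - N + s₁) * s₂) = 0 := by
  have e₂ : u₂ = ((x - 2 * k) * T + k * (N + 2 * k)) / x := by
    rw [eq_div_iff hx]; linear_combination h₂
  have e₂' : v₂ = (T + (x - 2 * k) * T₁ - u₂) / x := by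
    rw [eq_div_iff hx]; linear_combination h₂'
  have e₃ : u₃ = ((x - 2 * k) * u₂ - T₁ - T ^ 2 + (3 * k + N) * T) / x := by
    rw [eq_div_iff hx]; linear_combination h₃
  have e₃' : v₃ = (u₂ + (x - 2 * k) * v₂ - T₂ - 2 * T * T₁ + (3 * k + N) * T₁ - u₃) / x := by
    rw [eq_div_iff hx]; linear_combination h₃'
  have e₂₂ : u₂₂ = ((x - 2 * k) * v₂ + 2 * u₂ - 2 * u₃) / x := by
    rw [eq_div_iff hx]; linear_combination h₂₂
  have hT₃ : T₃ = -(6 * T₁ ^ 2 - 4 * v₃ + 3 * u₂₂) := by linear_combination hKP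
  rw [hs, hs₁, hs₂, hs₃, hT₃, e₂₂, e₃', e₃, e₂', e₂]
  field_simp
  ring

theorem sigmaPainleveV_of_deriv_sigmaForm {N k : ℕ} {U : Set ℂ} {T : ℂ → ℂ} (hU : IsOpen U)
    (hUc : IsPreconnected U) (h0 : 0 ∈ U) (hT : AnalyticOnNhd ℂ T U)
    (hT0 : T 0 = k + N / 2)
    (hode : ∀ x ∈ U, x ≠ 0 → ∀ s s₁ s₂ s₃ : ℂ, s = x * T x - k * x - N * k →
      s₁ = T x + x * deriv T x - k → s₂ = 2 * deriv T x + x * deriv (deriv T) x →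
      s₃ = 3 * deriv (deriv T) x + x * deriv (deriv (deriv T)) x →
      2 * (x * s₂) * (s₂ + x * s₃) -
      2 * (s - x * s₁ + 2 * s₁ ^ 2 - 2 * N * s₁) * (-x * s₂ + 4 * s₁ * s₂ - 2 * N * s₂) +
      4 * (s₂ * (-N + s₁) * (-k - N + s₁) * (k + s₁) + s₁ * s₂ * (-k - N + s₁) * (k + s₁) +
        s₁ * (-N + s₁) * s₂ * (k + s₁) + s₁ * (-N + s₁) * (-k - N + s₁) * s₂) = 0)
    {x : ℂ} (hx : x ∈ U) : SigmaPainleveV N k (fun x => x * T x - k * x - N * k) x := by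
  set σ : ℂ → ℂ := fun x => x * T x - k * x - N * k with hσ
  have hσ₁ {y : ℂ} (hy : y ∈ U) : HasDerivAt σ (T y + y * deriv T y - k) y := by
    refine ((((hasDerivAt_id y).mul (hT y hy).differentiableAt.hasDerivAt).sub
      ((hasDerivAt_id y).const_mul (k : ℂ))).sub_const (N * k : ℂ)).congr_deriv ?_
    simp
  have hσ₂ {y : ℂ} (hy : y ∈ U) :
      HasDerivAt (deriv σ) (2 * deriv T y + y * deriv (deriv T) y) y := by
    have h : HasDerivAt (fun y => T y + y * deriv T y - k)
        (2 * deriv T y + y * deriv (deriv T) y) y := by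
      refine (((hT y hy).differentiableAt.hasDerivAt.add ((hasDerivAt_id y).mul
        (hT y hy).deriv.differentiableAt.hasDerivAt)).sub_const (k : ℂ)).congr_deriv ?_
      simp only [id]
      ring
    exact h.congr_of_eventuallyEq ((hU.eventually_mem hy).mono
      fun z hz => (hσ₁ hz).deriv)
  have hσ₃ {y : ℂ} (hy : y ∈ U) :
      HasDerivAt (deriv (deriv σ)) (3 * deriv (deriv T) y + y * deriv (deriv (deriv T)) y) y := by
    have h : HasDerivAt (fun y => 2 * deriv T y + y * deriv (deriv T) y)
        (3 * deriv (deriv T) y + y * deriv (deriv (deriv T)) y) y := by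
      refine ((((hT y hy).deriv.differentiableAt.hasDerivAt.const_mul 2).add
        ((hasDerivAt_id y).mul (hT y hy).deriv.deriv.differentiableAt.hasDerivAt))).congr_deriv ?_
      simp only [id]
      ring
    exact h.congr_of_eventuallyEq ((hU.eventually_mem hy).mono
      fun z hz => (hσ₂ hz).deriv)
  have hσa : AnalyticOnNhd ℂ σ U := fun y hy =>
    ((analyticAt_id.mul (hT y hy)).sub (analyticAt_const.mul analyticAt_id)).sub analyticAt_const
  set G : ℂ → ℂ := fun x => (x * deriv (deriv σ) x) ^ 2 -
    (σ x - x * deriv σ x + 2 * (deriv σ x) ^ 2 - 2 * N * deriv σ x) ^ 2 +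
    4 * (deriv σ x * (-N + deriv σ x) * (-k - N + deriv σ x) * (k + deriv σ x)) with hG
  have hGa : AnalyticOnNhd ℂ G U := by
    intro y hy
    have a0 := hσa y hy
    have a1 := a0.deriv
    have a2 := a1.deriv
    have ai : AnalyticAt ℂ (fun y : ℂ => y) y := analyticAt_id
    have ac (c : ℂ) : AnalyticAt ℂ (fun _ : ℂ => c) y := analyticAt_const
    exact (((ai.mul a2).pow 2).sub
      ((((a0.sub (ai.mul a1)).add ((ac 2).mul (a1.pow 2))).sub ((ac (2 * N)).mul a1)).pow 2)).add
      ((ac 4).mul (((a1.mul ((ac (-N)).add a1)).mul ((ac (-k - N)).add a1)).mul ((ac k).add a1)))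
  have hG' {y : ℂ} (hy : y ∈ U) (hy0 : y ≠ 0) : deriv G y = 0 := by
    have d0 := (hσ₁ hy)
    have d1 := (hσ₂ hy)
    have d2 := (hσ₃ hy)
    have di := hasDerivAt_id y
    have hode' := hode y hy hy0 (σ y) (deriv σ y) (deriv (deriv σ) y) _ rfl d0.deriv d1.deriv rfl
    rw [← d2.deriv] at hode'
    rw [← d0.deriv] at d0
    rw [← d1.deriv] at d1
    rw [← d2.deriv] at d2
    have key := (((di.fun_mul d2).fun_pow 2).fun_sub
      ((((d0.fun_sub (di.fun_mul d1)).fun_add ((d1.fun_pow 2).const_mul 2)).fun_sub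
        (d1.const_mul (2 * N : ℂ))).fun_pow 2)).fun_add
      ((((d1.fun_mul (d1.const_add (-N : ℂ))).fun_mul (d1.const_add (-k - N : ℂ))).fun_mul
        (d1.const_add (k : ℂ))).const_mul 4)
    have key' : HasDerivAt G _ y := key
    rw [key'.deriv, ← hode']
    simp only [id]
    push_cast
    ring
  have hG0 : deriv G 0 = 0 := by
    have hc : Filter.Tendsto (deriv G) (nhdsWithin 0 {0}ᶜ) (nhds (deriv G 0)) :=
      (hGa 0 h0).deriv.continuousAt.continuousWithinAt
    have hc' : Filter.Tendsto (deriv G) (nhdsWithin 0 {0}ᶜ) (nhds 0) := by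
      refine tendsto_const_nhds.congr' ?_
      filter_upwards [self_mem_nhdsWithin, mem_nhdsWithin_of_mem_nhds (hU.mem_nhds h0)]
        with y hy0 hy
      exact (hG' hy hy0).symm
    exact tendsto_nhds_unique hc hc'
  have hconst : G x = G 0 := by
    refine hU.is_const_of_deriv_eq_zero hUc
      (fun y hy => (hGa y hy).differentiableAt.differentiableWithinAt) (fun y hy => ?_) hx h0
    by_cases hy0 : y = 0
    · rw [hy0]; exact hG0
    · exact hG' hy hy0
  have hG00 : G 0 = 0 := by
    have h1 : deriv σ 0 = N / 2 := by
      rw [(hσ₁ h0).deriv, hT0]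
      ring
    have h2 : σ 0 = -(N * k) := by simp [hσ]
    simp only [hG, h1, h2]
    ring
  rw [hG00] at hconst
  rw [SigmaPainleveV]
  linear_combination hconst

end Painleve

section HankelPainleve

open Matrix

variable {m : ℕ → ℂ → ℂ} {d : ℕ}

theorem analyticAt_trace_companionQ
    (hm : ∀ j x, HasDerivAt (m j) (m (j + 1) x) x) {x : ℂ} (hx : (hankelShift m d 0 x).det ≠ 0) :
    AnalyticAt ℂ (fun y => trace (companionQ m d y)) x :=
  DifferentiableOn.analyticAt (s := {x | (hankelShift m d 0 x).det ≠ 0})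
    (fun _ hy => (hasDerivAt_trace_companionQ hm hy).differentiableAt.differentiableWithinAt)
    (eventually_det_hankelShift_ne_zero hm hx)

theorem sigmaPainleveV_hankel
    (hm : ∀ j x, HasDerivAt (m j) (m (j + 1) x) x) {N : ℕ}
    (hrec : ∀ (x : ℂ) (j : ℕ), x * m (j + 2) x =
      (x - j - 2) * m (j + 1) x + (j + 1 + (N + (d + 1) : ℕ)) * m j x)
    (h0 : (hankelShift m d 0 0).det ≠ 0)
    (hT0 : trace (companionQ m d 0) = ((d + 1 : ℕ) : ℂ) + N / 2) {x : ℂ}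
    (hx : (hankelShift m d 0 x).det ≠ 0) :
    SigmaPainleveV N (d + 1)
      (fun x => x * trace (companionQ m d x) - (d + 1 : ℕ) * x - N * (d + 1 : ℕ)) x := by
  refine sigmaPainleveV_of_deriv_sigmaForm (U := {x | (hankelShift m d 0 x).det ≠ 0})
    (isOpen_det_hankelShift_ne_zero hm 0)
    (isPreconnected_ne_zero_of_differentiable (differentiable_det_hankelShift hm 0) h0) h0
    (fun y hy => analyticAt_trace_companionQ hm hy) hT0 ?_ hx
  clear hx x
  intro x hx hx0 s s₁ s₂ s₃ hs hs₁ hs₂ hs₃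
  have hU := eventually_det_hankelShift_ne_zero hm hx
  have dT := (analyticAt_trace_companionQ hm hx).differentiableAt.hasDerivAt
  have dT₁ := (analyticAt_trace_companionQ hm hx).deriv.differentiableAt.hasDerivAt
  have du₂ := hasDerivAt_trace_hankelInv_mul_hankelShift hm hx 2
  have du₃ := hasDerivAt_trace_hankelInv_mul_hankelShift hm hx 3
  have di := hasDerivAt_id x
  have hv₃ {y : ℂ} (hy : (hankelShift m d 0 y).det ≠ 0) :
      y * trace (hankelInv m d y * hankelShift m d 3 y) =
      (y - 2 * (d + 1)) * trace (hankelInv m d y * hankelShift m d 2 y) -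
        deriv (fun y => trace (companionQ m d y)) y - trace (companionQ m d y) ^ 2 +
        (2 * (d + 1) + (N + (d + 1) : ℕ)) * trace (companionQ m d y) := by
    rw [(hasDerivAt_trace_companionQ hm hy).deriv]
    exact virasoro_three hy (hrec y)
  have h₂' := (di.fun_mul du₂).unique ((((di.sub_const (2 * (d + 1) : ℂ)).fun_mul dT).add_const
    ((d + 1) * (d + 1 + (N + (d + 1) : ℕ)) : ℂ)).congr_of_eventuallyEq
      (hU.mono fun y hy => virasoro_two hy (hrec y)))
  have h₃' := (di.fun_mul du₃).unique (((((di.sub_const (2 * (d + 1) : ℂ)).fun_mul du₂).fun_sub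
    dT₁).fun_sub (dT.fun_pow 2)).fun_add (dT.const_mul (2 * (d + 1) + (N + (d + 1) : ℕ) : ℂ))
    |>.congr_of_eventuallyEq (hU.mono fun y hy => hv₃ hy))
  have hKP := kadomtsev_petviashvili_hankel hm hx
  rw [du₃.deriv] at hKP
  simp only [id, Nat.reduceAdd] at h₂' h₃' hKP
  push_cast at h₂' h₃' hs hs₁ ⊢
  refine deriv_sigmaForm_eq_zero (u₂ := trace (hankelInv m d x * hankelShift m d 2 x))
    (v₂ := trace (hankelInv m d x * hankelShift m d 3 x) -
      trace (hankelInv m d x * hankelShift m d 2 x * companionQ m d x))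
    (u₃ := trace (hankelInv m d x * hankelShift m d 3 x)) hx0 ?_ ?_ ?_ ?_ ?_ hKP hs hs₁ hs₂ hs₃
  · rw [virasoro_two hx (hrec x)]
    push_cast
    ring
  · linear_combination h₂'
  · rw [hv₃ hx]
    push_cast
    ring
  · linear_combination h₃'
  · exact virasoro_two_two hx (hrec x)

end HankelPainleve

theorem theorem1 (N k : ℕ) (hk : 1 ≤ k) (hN : k ≤ N) (r : ℝ) (hr0 : 0 < r) (hr1 : r < 1) :
    (∀ y : ℝ,
      ((Matrix.det (Matrix.of fun i j : Fin k =>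
          laguerreL (2 * (k : ℝ) - 1) (N + k - 1 - ((i : ℕ) + (j : ℕ))) (-2 * |y|)) : ℝ) : ℂ) =
        Complex.exp (-2 * (k : ℂ) * ((|y| : ℝ) : ℂ)) / (2 * (Real.pi : ℂ) * Complex.I) ^ k *
          hankelDet r k (weightW N k (((2 * |y| : ℝ)) : ℂ))) ∧
    ∃ H σ : ℂ → ℂ,
      (∀ x, H x = hankelDet r k (weightW N k x)) ∧
      Differentiable ℂ H ∧ H 0 ≠ 0 ∧
      AnalyticOnNhd ℂ σ {x | H x ≠ 0} ∧
      (∀ x, H x ≠ 0 → x ≠ 0 → logDeriv H x = (σ x + k * x + N * k) / x) ∧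
      (∀ x, H x ≠ 0 → SigmaPainleveV N k σ x) ∧
      (fun x => σ x - (-(N : ℂ) * k + (N : ℂ) / 2 * x)) =O[nhds 0] (fun x => x ^ 2) := by
  constructor
  · intro y
    have hentry (i j : Fin k) : (∮ s in C(0, r), weightW N k ((2 * |y| : ℝ) : ℂ) s *
        s ^ ((i : ℕ) + (j : ℕ))) = (2 * Real.pi * Complex.I * Complex.exp ((2 * |y| : ℝ) : ℂ)) *
        ((laguerreL (2 * (k : ℝ) - 1) (N + k - 1 - ((i : ℕ) + (j : ℕ))) (-2 * |y|) : ℝ) : ℂ) := by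
      rw [weightW_moment hr0 hr1 (by omega), show N + k - (i + j) = N + k - 1 - (i + j) + 1 by omega,
        show 2 * k = (2 * k - 1) + 1 by omega, expMoment_eq_sum hr0 hr1,
        neg_mul, laguerreL_two_mul_sub_one k _ hk]
      push_cast
      rfl
    have hdet : hankelDet r k (weightW N k ((2 * |y| : ℝ) : ℂ)) =
        (2 * Real.pi * Complex.I * Complex.exp ((2 * |y| : ℝ) : ℂ)) ^ k *
        ((Matrix.det (Matrix.of fun i j : Fin k =>
          laguerreL (2 * (k : ℝ) - 1) (N + k - 1 - ((i : ℕ) + (j : ℕ))) (-2 * |y|)) : ℝ) : ℂ) := by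
      rw [hankelDet]
      simp only [hentry]
      have hmap := (RingHom.map_det Complex.ofRealHom (Matrix.of fun i j : Fin k =>
        laguerreL (2 * (k : ℝ) - 1) (N + k - 1 - ((i : ℕ) + (j : ℕ))) (-2 * |y|)))
      rw [Complex.ofRealHom_eq_coe] at hmap
      rw [hmap]
      have hsmul := Matrix.det_smul (Complex.ofRealHom.mapMatrix (Matrix.of fun i j : Fin k =>
        laguerreL (2 * (k : ℝ) - 1) (N + k - 1 - ((i : ℕ) + (j : ℕ))) (-2 * |y|)))
        (2 * Real.pi * Complex.I * Complex.exp ((2 * |y| : ℝ) : ℂ))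
      rw [Fintype.card_fin] at hsmul
      rw [← hsmul]
      rfl
    have hpi : (2 * (Real.pi : ℂ) * Complex.I) ^ k ≠ 0 :=
      pow_ne_zero _ Complex.two_pi_I_ne_zero
    have hexp : Complex.exp (-2 * (k : ℂ) * ((|y| : ℝ) : ℂ)) *
        Complex.exp ((2 * |y| : ℝ) : ℂ) ^ k = 1 := by
      rw [← Complex.exp_nat_mul, ← Complex.exp_add, Complex.exp_eq_one_iff]
      refine ⟨0, ?_⟩
      push_cast
      ring
    rw [hdet, mul_pow _ (Complex.exp _), div_mul_eq_mul_div, eq_div_iff hpi]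
    linear_combination (-(2 * (Real.pi : ℂ) * Complex.I) ^ k * ((Matrix.det (Matrix.of
      fun i j : Fin k => laguerreL (2 * (k : ℝ) - 1) (N + k - 1 - ((i : ℕ) + (j : ℕ)))
        (-2 * |y|)) : ℝ) : ℂ)) * hexp
  · obtain ⟨d, rfl⟩ : ∃ d, k = d + 1 := ⟨k - 1, by omega⟩
    set m : ℕ → ℂ → ℂ := fun j => expMoment r (j + 2) (N + (d + 1)) with hmdef
    have hm : ∀ j x, HasDerivAt (m j) (m (j + 1) x) x := fun j x =>
      hasDerivAt_expMoment hr0 hr1 (j + 2) _ x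
    have hrec : ∀ (x : ℂ) (j : ℕ), x * m (j + 2) x =
        (x - j - 2) * m (j + 1) x + (j + 1 + (N + (d + 1) : ℕ)) * m j x := fun x j =>
      expMoment_recurrence hr0 hr1 (N + d) x j
    have h0 : (hankelShift m d 0 0).det ≠ 0 := by
      refine det_hankel_ne_zero_of_recurrence (μ := fun j => m j 0) (a := N + (d + 1))
        (by omega) ?_ fun j => ?_
      · simp only [hmdef]
        rw [← add_assoc, expMoment_apply_zero hr0 hr1]
        refine mul_ne_zero Complex.two_pi_I_ne_zero ?_
        exact_mod_cast (Nat.choose_pos (by omega)).ne'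
      · linear_combination hrec 0 j
    have hT0 : Matrix.trace (companionQ m d 0) = ((d + 1 : ℕ) : ℂ) + N / 2 := by
      have h := virasoro_two h0 (hrec 0)
      have hd : ((d : ℂ) + 1) ≠ 0 := by exact_mod_cast d.succ_ne_zero
      push_cast at h ⊢
      apply mul_left_cancel₀ hd
      linear_combination h / 2
    have hlog {x : ℂ} (hx : (hankelShift m d 0 x).det ≠ 0) :
        logDeriv (fun x => (hankelShift m d 0 x).det) x = Matrix.trace (companionQ m d x) := by
      rw [logDeriv_apply, (hasDerivAt_det_hankelShift hm hx).deriv, mul_div_cancel_left₀ _ hx]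
    refine ⟨fun x => (hankelShift m d 0 x).det,
      fun x => x * Matrix.trace (companionQ m d x) - (d + 1 : ℕ) * x - N * (d + 1 : ℕ),
      fun x => (hankelDet_weightW_eq hr0 hr1 N d x).symm, differentiable_det_hankelShift hm 0, h0,
      fun x hx => ?_, fun x hx hx0 => ?_, fun x hx => sigmaPainleveV_hankel hm hrec h0 hT0 hx, ?_⟩
    · exact ((analyticAt_id.mul (analyticAt_trace_companionQ hm hx)).sub
        (analyticAt_const.mul analyticAt_id)).sub analyticAt_const
    · rw [hlog hx, eq_div_iff hx0]
      ring
    · have hO : (fun x => Matrix.trace (companionQ m d x) - Matrix.trace (companionQ m d 0)) =O[nhds 0]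
          fun x : ℂ => x - 0 := (analyticAt_trace_companionQ hm h0).differentiableAt.isBigO_sub
      refine ((Asymptotics.isBigO_refl (fun x : ℂ => x) (nhds 0)).mul hO).congr
        (fun x => ?_) fun x => ?_
      · rw [hT0]
        ring
      · ring
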